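/- Let $S_\infty$ be the group of finitely supported permutations of $\mathbb N$, acting on $\mathbb Z_2^\infty=\bigoplus_{\mathbb N}\mathbb Z_2$ by permuting coordinates, and let $G=S_\infty\ltimes\mathbb Z_2^\infty$. For a countable group $\Gamma$, let $L(\Gamma)\subseteq B(\ell^2(\Gamma))$ be the von Neumann algebra generated by the left translations $u_g$, $g\in\Gamma$ (we write $g$ for $u_g$), with canonical trace $\tau(x)=\langle\delta_e,x\delta_e\rangle$. A von Neumann subalgebra $\mathcal M\subseteq L(\Gamma)$ is called invariant if $u_g\mathcal M u_g^*\subseteq\mathcal M$ for all $g\in\Gamma$, and exotic if it is not equal to $L(N)$ for any normal subgroup $N\trianglelefteq\Gamma$. Let $P_1\in L(\mathbb Z_2)$ be a non-trivial orthogonal projection, that is, $P_1\neq 0$ and $P_1\neq 1$, and let $P_2=P_1^\perp=1-P_1$. For $l\in\{1,2\}$ and $n\in\mathbb N$ let $P_l^{(n)}\in L(G)$ be the image of $P_l$ under the embedding of $L(\mathbb Z_2)$ in $L(G)$ induced by the inclusion of $\mathbb Z_2$ as the $n$-th coordinate of $\mathbb Z_2^\infty$, and for a finite set $K\subset\mathbb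 N$ let $P_l^K=\prod_{n\in K}P_l^{(n)}$. Let $\mathrm{Part}$ be the set of all partitions of $\mathbb N$ into finite sets of which only finitely many have more than one element. Let $\mathcal C\subseteq L(G)$ be the set of all operators $$s\cdot\prod_{K\in\mathcal K}\bigl(P_1^K+\mathrm{sign}(s|_K)\,P_2^K\bigr),\qquad s\in S_\infty,\ \mathcal K\in\mathrm{Part},\ s(K)=K\text{ for all }K\in\mathcal K$$ (the factors at one-point sets $K$ are equal to $1$, so that the product is finite). Then the weak* closed linear span $\mathcal M_{\mathrm{Part}}=\overline{\mathrm{Lin}(\mathcal C)}^{w^*}$ is an exotic invariant von Neumann subalgebra of $L(G)$. Moreover, there is a unique $\tau$-preserving conditional expectation $E:L(G)\to\mathcal M_{\mathrm{Part}}$, and it satisfies $E((12))=0$, where $(12)\in S_\infty$ is the transposition of $1$ and $2$. -/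

import Mathlib

open scoped InnerProductSpace

noncomputable section

namespace WreathVN

/-! ### Group von Neumann algebras -/

/-- The Hilbert space `ℓ²(G)`. -/
abbrev L2 (G : Type*) : Type _ := lp (fun _ : G => ℂ) 2

/-- The basis vector `δ_g` of `ℓ²(G)`. -/
def delta {G : Type*} (g : G) : L2 G := by
  classical exact lp.single 2 g 1

theorem delta_apply {G : Type*} [DecidableEq G] (g x : G) :
    delta g x = if x = g then 1 else 0 := by
  by_cases h : x = g
  · subst h; simp [delta]
  · simp [delta, h]

/-- The composition of an `ℓ²` function with a permutation of the index set is `ℓ²`. -/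
theorem memlp_comp {G : Type*} (σ : Equiv.Perm G) (f : L2 G) :
    Memℓp (fun x => f (σ x)) 2 := by
  have h2 : 0 < (2 : ENNReal).toReal := by norm_num
  have h := (memℓp_gen_iff h2).1 (lp.memℓp f)
  exact (memℓp_gen_iff h2).2 ((Equiv.summable_iff σ).2 h)

/-- The linear isometry `f ↦ f ∘ σ` of `ℓ²(G)`, for a permutation `σ` of `G`. -/
def compPerm {G : Type*} (σ : Equiv.Perm G) : L2 G →ₗᵢ[ℂ] L2 G where
  toFun f := ⟨fun x => f (σ x), memlp_comp σ f⟩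
  map_add' f g := by ext x; rfl
  map_smul' c f := by ext x; rfl
  norm_map' f := by
    have h2 : 0 < (2 : ENNReal).toReal := by norm_num
    rw [lp.norm_eq_tsum_rpow h2, lp.norm_eq_tsum_rpow h2]
    congr 1
    exact Equiv.tsum_eq σ (fun x => ‖f x‖ ^ (2 : ENNReal).toReal)

/-- The left regular representation `g ↦ u_g`, `(u_g f)(x) = f (g⁻¹ x)`. -/
def leftReg (G : Type*) [Group G] : G →* (L2 G →L[ℂ] L2 G) where
  toFun g := (compPerm (Equiv.mulLeft g⁻¹)).toContinuousLinearMap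
  map_one' := by
    ext f x
    change f ((1 : G)⁻¹ * x) = f x
    simp
  map_mul' g h := by
    ext f x
    change f ((g * h)⁻¹ * x) = f (h⁻¹ * (g⁻¹ * x))
    simp [mul_assoc]

theorem leftReg_delta {G : Type*} [Group G] (g h : G) :
    leftReg G g (delta h) = delta (g * h) := by
  classical
  ext x
  change (delta h) (g⁻¹ * x) = (delta (g * h)) x
  simp only [delta, lp.single_apply]
  by_cases hx : x = g * h
  · subst hx; simp
  · have : g⁻¹ * x ≠ h := fun h' => hx (by rw [← h']; simp)
    simp [hx, this]

/-- The von Neumann algebra generated by a set `S` of bounded operators: the bicommutant of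
`S ∪ S*`. -/
def vnGenerated {H : Type*} [NormedAddCommGroup H] [InnerProductSpace ℂ H] [CompleteSpace H]
    (S : Set (H →L[ℂ] H)) : VonNeumannAlgebra H where
  toStarSubalgebra :=
    StarSubalgebra.centralizer ℂ (StarSubalgebra.centralizer ℂ S : Set (H →L[ℂ] H))
  centralizer_centralizer' := by
    change Set.centralizer (Set.centralizer (Set.centralizer _)) = Set.centralizer _
    rw [Set.centralizer_centralizer_centralizer]

theorem subset_vnGenerated {H : Type*} [NormedAddCommGroup H] [InnerProductSpace ℂ H]
    [CompleteSpace H] (S : Set (H →L[ℂ] H)) {x : H →L[ℂ] H} (hx : x ∈ S) :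
    x ∈ vnGenerated S := by
  change x ∈ Set.centralizer (_ ∪ star _)
  intro y hy
  have hy' : y ∈ StarSubalgebra.centralizer ℂ S := by
    rcases hy with hy | hy
    · exact hy
    · have := star_mem (Set.mem_star.1 hy)
      rwa [star_star] at this
  exact ((StarSubalgebra.mem_centralizer_iff ℂ).1 hy' x hx).1.symm

/-- The copy of `L(N)` inside `B(ℓ²(G))`, for a subgroup `N` of `G`: the von Neumann algebra
generated by the `u_g` with `g ∈ N`. -/
def subgroupVN {G : Type*} [Group G] (N : Subgroup G) : VonNeumannAlgebra (L2 G) :=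
  vnGenerated (leftReg G '' (N : Set G))

/-- The group von Neumann algebra `L(G)`. -/
def groupVN (G : Type*) [Group G] : VonNeumannAlgebra (L2 G) :=
  vnGenerated (Set.range (leftReg G))

theorem leftReg_mem {G : Type*} [Group G] (g : G) : leftReg G g ∈ groupVN G :=
  subset_vnGenerated _ ⟨g, rfl⟩

/-- The canonical trace `τ(x) = ⟨δ_e, x δ_e⟩`. -/
def trace {G : Type*} [Group G] (x : L2 G →L[ℂ] L2 G) : ℂ :=
  ⟪delta (1 : G), x (delta 1)⟫_ℂ

/-- The Fourier coefficient `c_g` of `x = ∑ c_g u_g`, that is, `x δ_e = ∑ c_g δ_g`. -/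
def fourierCoeff {G : Type*} [Group G] (x : L2 G →L[ℂ] L2 G) (g : G) : ℂ :=
  x (delta 1) g

/-- Invariance under the adjoint action of `G`. -/
def IsInvariant {G : Type*} [Group G] (M : VonNeumannAlgebra (L2 G)) : Prop :=
  ∀ g : G, ∀ m ∈ M, leftReg G g * m * star (leftReg G g) ∈ M

/-- `M` is exotic if it is not of the form `L(N)` for a normal subgroup `N`. -/
def IsExotic {G : Type*} [Group G] (M : VonNeumannAlgebra (L2 G)) : Prop :=
  ∀ N : Subgroup G, N.Normal → M ≠ subgroupVN N

/-- `E : L(G) → M` is a conditional expectation (a positive `M`-bimodular projection onto `M`)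
which preserves the trace. -/
structure IsTraceCondExp {G : Type*} [Group G] {M : VonNeumannAlgebra (L2 G)}
    (hM : M ≤ groupVN G)
    (E : (groupVN G).toStarSubalgebra →ₗ[ℂ] M.toStarSubalgebra) : Prop where
  apply_mem : ∀ m : M.toStarSubalgebra, E ⟨m.1, hM m.2⟩ = m
  bimodule : ∀ (a b : M.toStarSubalgebra) (x : (groupVN G).toStarSubalgebra),
    E (⟨a.1, hM a.2⟩ * x * ⟨b.1, hM b.2⟩) = a * E x * b
  positive : ∀ x : (groupVN G).toStarSubalgebra, x.1.IsPositive → (E x).1.IsPositive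
  trace_eq : ∀ x : (groupVN G).toStarSubalgebra, trace (E x).1 = trace x.1

/-! ### The weak* topology -/

/-- The weak* (ultraweak) topology on `B(H)`, given by the predual of trace class operators:
the coarsest topology for which all functionals `T ↦ ∑ ⟨xₙ, T yₙ⟩`, with
`∑ ‖xₙ‖² < ∞` and `∑ ‖yₙ‖² < ∞`, are continuous. -/
@[reducible] def weakStarTopology (H : Type*) [NormedAddCommGroup H] [InnerProductSpace ℂ H] :
    TopologicalSpace (H →L[ℂ] H) :=
  ⨅ (x : lp (fun _ : ℕ => H) 2) (y : lp (fun _ : ℕ => H) 2),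
    TopologicalSpace.induced (fun T : H →L[ℂ] H => ∑' n, ⟪x n, T (y n)⟫_ℂ) inferInstance

/-- The weak* closure of a set of bounded operators. -/
def weakStarClosure {H : Type*} [NormedAddCommGroup H] [InnerProductSpace ℂ H]
    (S : Set (H →L[ℂ] H)) : Set (H →L[ℂ] H) :=
  @closure _ (weakStarTopology H) S

/-! ### The group `S_∞ ⋉ ℤ₂^∞` -/

/-- The group `ℤ₂`, written multiplicatively. -/
abbrev Z2 : Type := Multiplicative (ZMod 2)

/-- The group `ℤ₂^∞ = ⨁_ℕ ℤ₂`, written multiplicatively. -/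
abbrev Z2Inf : Type := Multiplicative (ℕ →₀ ZMod 2)

/-- The inclusion of `ℤ₂` in `ℤ₂^∞` at the `n`-th coordinate. -/
def coord (n : ℕ) : Z2 →* Z2Inf :=
  AddMonoidHom.toMultiplicative (Finsupp.singleAddHom n)

/-- The group `S_∞` of finite permutations of `ℕ`. -/
def SInf : Subgroup (Equiv.Perm ℕ) where
  carrier := {s | {n | s n ≠ n}.Finite}
  one_mem' := by simp
  mul_mem' {s t} hs ht := by
    refine (Set.Finite.union hs ht).subset fun n hn => ?_
    by_contra h
    simp only [Set.mem_union, Set.mem_ofPred_eq, not_or, not_not] at h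
    exact hn (by rw [Equiv.Perm.mul_apply, h.2, h.1])
  inv_mem' {s} hs := by
    refine Set.Finite.subset hs fun n hn h => hn ?_
    rw [Equiv.Perm.inv_eq_iff_eq]
    exact h.symm

/-- The transposition `(i j)` as an element of `S_∞`. -/
def transposition (i j : ℕ) : SInf :=
  ⟨Equiv.swap i j, by
    refine Set.Finite.subset (Set.toFinite {i, j}) fun n hn => ?_
    by_contra h
    simp only [Set.mem_insert_iff, Set.mem_singleton_iff, not_or] at h
    exact hn (Equiv.swap_apply_of_ne_of_ne h.1 h.2)⟩

/-- The action of `S_∞` on `ℤ₂^∞` by permutation of coordinates: `(s · v)(s(n)) = v(n)`. -/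
def permAction : SInf →* MulAut Z2Inf where
  toFun s := AddEquiv.toMultiplicative (Finsupp.domCongr (s : Equiv.Perm ℕ))
  map_one' := by
    ext v n
    rfl
  map_mul' s t := by
    ext v n
    rfl

/-- The group `G = S_∞ ⋉ ℤ₂^∞`. -/
abbrev WreathG : Type := Z2Inf ⋊[permAction] SInf

/-! ### Partitions and the operators in `𝒞` -/

/-- A partition of `ℕ` into finite sets, only finitely many of which have more than one
element. -/
structure Part where
  parts : Set (Finset ℕ)
  empty_notMem : ∅ ∉ parts
  cover : ∀ n : ℕ, ∃! K, K ∈ parts ∧ n ∈ K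
  finite : {K ∈ parts | 1 < K.card}.Finite

/-- The permutation `s` maps each part of `𝒦` onto itself. -/
def Preserves (s : SInf) (𝒦 : Part) : Prop :=
  ∀ K ∈ 𝒦.parts, ∀ n, s.1 n ∈ K ↔ n ∈ K

/-- The copy `Q^(n)` in `L(ℤ₂^(n))` of `Q = ∑ c_z u_z ∈ L(ℤ₂)`, as an element of the group algebra
of `ℤ₂^∞`. -/
def copyAt (Q : L2 Z2 →L[ℂ] L2 Z2) (n : ℕ) : MonoidAlgebra ℂ Z2Inf :=
  ∑ z : Z2, MonoidAlgebra.single (coord n z) (fourierCoeff Q z)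

/-- The element `Q^K = ∏_{n ∈ K} Q^(n)`. -/
def copyOn (Q : L2 Z2 →L[ℂ] L2 Z2) (K : Finset ℕ) : MonoidAlgebra ℂ Z2Inf :=
  ∏ n ∈ K, copyAt Q n

/-- The natural embedding of the group algebra of `ℤ₂^∞` in `B(ℓ²(G))`. -/
def toOperator : MonoidAlgebra ℂ Z2Inf →ₐ[ℂ] (L2 WreathG →L[ℂ] L2 WreathG) :=
  MonoidAlgebra.lift ℂ (L2 WreathG →L[ℂ] L2 WreathG) Z2Inf
    ((leftReg WreathG).comp SemidirectProduct.inl)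

/-- The element `∏_{K ∈ 𝒦} (P₁^K + sign(s|_K) P₂^K)` with `P₂ = 1 - P₁`. The factors at one-point
parts are `P₁^K + P₂^K = 1`, so that the product has only finitely many factors other than `1`. -/
def partProduct (P₁ : L2 Z2 →L[ℂ] L2 Z2) (s : SInf) (𝒦 : Part) (hs : Preserves s 𝒦) :
    MonoidAlgebra ℂ Z2Inf :=
  ∏ᶠ K : 𝒦.parts, (copyOn P₁ K.1 +
    (Equiv.Perm.sign (s.1.subtypePerm (p := fun n => n ∈ K.1) (hs K.1 K.2)) : ℤ) •
      copyOn (1 - P₁) K.1)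

theorem copyAt_add_copyAt (P₁ : L2 Z2 →L[ℂ] L2 Z2) (n : ℕ) :
    copyAt P₁ n + copyAt (1 - P₁) n = 1 := by
  have h : ∀ z : Z2, fourierCoeff P₁ z + fourierCoeff (1 - P₁) z = if z = 1 then 1 else 0 := by
    intro z
    have : fourierCoeff P₁ z + fourierCoeff (1 - P₁) z = (delta (1 : Z2)) z := by
      simp [fourierCoeff]
    rw [this, delta_apply]
  rw [copyAt, copyAt, ← Finset.sum_add_distrib]
  simp only [← MonoidAlgebra.single_add, h]
  rw [Finset.sum_eq_single 1]
  · simp [MonoidAlgebra.one_def]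
  · intro b _ hb
    simp [hb]
  · simp

/-- All but finitely many factors of the product over the partition are `1`. -/
theorem partProduct_finite (P₁ : L2 Z2 →L[ℂ] L2 Z2) (s : SInf) (𝒦 : Part) (hs : Preserves s 𝒦) :
    (Function.mulSupport fun K : 𝒦.parts => (copyOn P₁ K.1 +
      (Equiv.Perm.sign (s.1.subtypePerm (p := fun n => n ∈ K.1) (hs K.1 K.2)) : ℤ) •
        copyOn (1 - P₁) K.1)).Finite := by
  refine (𝒦.finite.preimage (f := Subtype.val) Subtype.val_injective.injOn).subset ?_
  rintro ⟨K, hK⟩ h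
  refine ⟨hK, ?_⟩
  by_contra hc
  have hne : K.Nonempty := by
    rw [Finset.nonempty_iff_ne_empty]
    rintro rfl
    exact 𝒦.empty_notMem hK
  obtain ⟨n, rfl⟩ := Finset.card_eq_one.1
    (le_antisymm (not_lt.1 hc) (Finset.card_pos.2 hne))
  refine h ?_
  have hsub : Subsingleton {x // x ∈ ({n} : Finset ℕ)} :=
    ⟨fun a b => Subtype.ext ((Finset.mem_singleton.1 a.2).trans (Finset.mem_singleton.1 b.2).symm)⟩
  have hsign : Equiv.Perm.sign (s.1.subtypePerm (p := fun k => k ∈ ({n} : Finset ℕ))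
      (hs {n} hK)) = 1 := by
    rw [Subsingleton.elim (s.1.subtypePerm (p := fun k => k ∈ ({n} : Finset ℕ)) (hs {n} hK)) 1,
      Equiv.Perm.sign_one]
  simp only [hsign, Units.val_one, one_smul, copyOn, Finset.prod_singleton]
  exact copyAt_add_copyAt P₁ n

/-- The collection `𝒞` of the operators `s · ∏_{K ∈ 𝒦} (P₁^K + sign(s|_K) P₂^K)`, where
`s ∈ S_∞`, `𝒦 ∈ Part` and `s(K) = K` for all `K ∈ 𝒦`. -/
def operatorsC (P₁ : L2 Z2 →L[ℂ] L2 Z2) : Set (L2 WreathG →L[ℂ] L2 WreathG) :=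
  {T | ∃ (s : SInf) (𝒦 : Part) (hs : Preserves s 𝒦),
    T = leftReg WreathG (SemidirectProduct.inr s) * toOperator (partProduct P₁ s 𝒦 hs)}

/-- The weak* closed linear span `M_Part` of `𝒞`. -/
def mPart (P₁ : L2 Z2 →L[ℂ] L2 Z2) : Set (L2 WreathG →L[ℂ] L2 WreathG) :=
  weakStarClosure (Submodule.span ℂ (operatorsC P₁) : Set (L2 WreathG →L[ℂ] L2 WreathG))

end WreathVN

end

open Filter Topology

noncomputable section

namespace WreathVN

/-! ### Operators on `ℓ²(G)` -/

section Basis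

variable {G : Type*}

/-! The span of `𝒞` is identified with a relative commutant that does not involve the projection.
Let `χ(v, s) = sign(s) (-1)^{|v|}`, a character of `G`, and let `parityOp` be multiplication by `χ`
on `ℓ²(G)`; it implements the automorphism `u_g ↦ χ(g) u_g` of `L(G)`. The claim is that `M_Part` is
`wreathVN`, the set of elements of `L(G)` that commute with `L(ℤ₂^∞)` and with `parityOp`.

Elements of the group algebra of `ℤ₂^∞` are read as functions on its dual, the characters `x : ℕ →
{±1}`. A non-trivial projection of `L(ℤ₂)` is `(1 ± u)/2`, so `P₁^(n)` becomes the indicator of `x n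
= ε`. A product over a partition preserved by `s` is then supported on characters constant on the
non-trivial parts, hence fixed by `s`; this gives commutation with `L(ℤ₂^∞)`. Replacing `x` by `-x`
exchanges `P₁` and `P₂` and multiplies the product by `sign(s)`; this gives commutation with
`parityOp`. Hence `mPart_subset`.

Conversely, cut the Fourier series of an element of `wreathVN` down to a finite subgroup `level n`.
The cuts are bounded in norm and converge weak* (`tendsto_trunc`). Each is a finite sum of terms `s
· f` in which `f` depends on finitely many coordinates, is supported on `s`-fixed characters and
takes the factor `sign(s)` under `x ↦ -x`. Such an `f` is a combination of sums of two complementary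
atoms, which are obtained from partitions with at most two non-trivial parts (`atom_add_mem_span`,
`mul_toOperator_mem_span`).

With this description, invariance holds because `ℤ₂^∞` is normal and `χ` is a character. The algebra
is exotic because it contains the sum of two group elements `twisted 1`, `twisted 2` but not the
first one alone. The expectation is a weak limit of averages over conjugation by `u_v` and `u_v ·
parityOp`, and `(12)` averages to zero because `χ(12) = -1`. -/

theorem inner_delta_left (g : G) (f : L2 G) : ⟪delta g, f⟫_ℂ = f g := by
  classical
  simp only [delta]
  convert! lp.inner_single_left (𝕜 := ℂ) (G := fun _ : G => ℂ) g (1 : ℂ) f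
  simp

theorem delta_apply_self (g : G) : delta g g = 1 := by
  classical simp [delta_apply]

theorem delta_apply_ne {g h : G} (hne : h ≠ g) : delta g h = 0 := by
  classical simp [delta_apply, hne]

theorem delta_injective : Function.Injective (delta : G → L2 G) := fun g h hgh => by
  by_contra hne
  have := delta_apply_self g
  rw [hgh, delta_apply_ne hne] at this
  exact zero_ne_one this

/-- Continuous linear maps on `ℓ²(G)` are determined by the basis. -/
theorem ext_delta {F : Type*} [NormedAddCommGroup F] [NormedSpace ℂ F] {S T : L2 G →L[ℂ] F}
    (h : ∀ g, S (delta g) = T (delta g)) : S = T := by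
  classical
  refine lp.ext_continuousLinearMap (p := 2) (by norm_num) fun g => ?_
  ext
  simpa [delta] using h g

theorem dense_span_delta : Dense (Submodule.span ℂ (Set.range (delta : G → L2 G)) : Set (L2 G)) := by
  classical
  intro f
  have h := lp.hasSum_single (p := 2) (by norm_num) f
  refine mem_closure_of_tendsto h (Eventually.of_forall fun s => ?_)
  refine Submodule.sum_mem _ fun g _ => ?_
  have : lp.single 2 g (f g) = f g • (delta g : L2 G) := by
    ext x
    simp [delta_apply, Pi.single_apply]
  rw [this]
  exact Submodule.smul_mem _ _ (Submodule.subset_span ⟨g, rfl⟩)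

/-- Multiplication by a function bounded by `1`. -/
def mulOp (m : G → ℂ) (hm : ∀ g, ‖m g‖ ≤ 1) : L2 G →L[ℂ] L2 G :=
  have h2 : 0 < (2 : ENNReal).toReal := by norm_num
  have hle (f : L2 G) (g : G) :
      ‖m g * f g‖ ^ (2 : ENNReal).toReal ≤ ‖f g‖ ^ (2 : ENNReal).toReal := by
    refine Real.rpow_le_rpow (norm_nonneg _) ?_ h2.le
    rw [norm_mul]
    exact mul_le_of_le_one_left (norm_nonneg _) (hm g)
  have hs (f : L2 G) : Summable fun g => ‖f g‖ ^ (2 : ENNReal).toReal :=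
    (memℓp_gen_iff h2).1 (lp.memℓp f)
  have hs' (f : L2 G) : Summable fun g => ‖m g * f g‖ ^ (2 : ENNReal).toReal :=
    Summable.of_nonneg_of_le (fun _ => by positivity) (hle f) (hs f)
  LinearMap.mkContinuous
    { toFun := fun f => ⟨fun g => m g * f g, (memℓp_gen_iff h2).2 (hs' f)⟩
      map_add' := fun f f' => by ext g; exact mul_add _ _ _
      map_smul' := fun c f => by ext g; exact mul_left_comm _ _ _ } 1 fun f => by
    rw [one_mul, lp.norm_eq_tsum_rpow h2, lp.norm_eq_tsum_rpow h2]
    exact Real.rpow_le_rpow (tsum_nonneg fun _ => by positivity)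
      ((hs' f).tsum_le_tsum (hle f) (hs f)) (by positivity)

theorem mulOp_apply (m : G → ℂ) (hm : ∀ g, ‖m g‖ ≤ 1) (f : L2 G) (g : G) :
    mulOp m hm f g = m g * f g := rfl

theorem mulOp_delta (m : G → ℂ) (hm : ∀ g, ‖m g‖ ≤ 1) (g : G) :
    mulOp m hm (delta g) = m g • delta g := by
  classical
  ext x
  rw [mulOp_apply, lp.coeFn_smul, Pi.smul_apply, smul_eq_mul, delta_apply]
  split_ifs with h
  · rw [h]
  · simp

/-- The projection onto the functions supported on `A`. -/
def indicatorOp (A : Set G) : L2 G →L[ℂ] L2 G :=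
  mulOp (A.indicator 1) fun g => by
    by_cases h : g ∈ A <;> simp [h]

theorem indicatorOp_apply (A : Set G) (f : L2 G) (g : G) :
    indicatorOp A f g = A.indicator f g := by
  rw [indicatorOp, mulOp_apply]
  by_cases h : g ∈ A <;> simp [h]

theorem norm_sq_eq_tsum_ennreal (f : L2 G) :
    ENNReal.ofReal (‖f‖ ^ 2) = ∑' g, ENNReal.ofReal (‖f g‖ ^ 2) := by
  have h2 : 0 < (2 : ENNReal).toReal := by norm_num
  have hs := (memℓp_gen_iff h2).1 (lp.memℓp f)
  have h := lp.norm_rpow_eq_tsum h2 f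
  simp only [ENNReal.toReal_ofNat, Real.rpow_ofNat] at h hs
  rw [h, ENNReal.ofReal_tsum_of_nonneg (fun _ => by positivity) hs]

/-- A block-diagonal compression of `x` has norm at most `‖x‖`. -/
theorem norm_le_of_blockDiagonal {κ : Type*} (π : G → κ) (T x : L2 G →L[ℂ] L2 G)
    (h : ∀ f g, T f g = x (indicatorOp (π ⁻¹' {π g}) f) g) : ‖T‖ ≤ ‖x‖ := by
  refine T.opNorm_le_bound (norm_nonneg _) fun f => ?_
  have key : ENNReal.ofReal (‖T f‖ ^ 2) ≤ ENNReal.ofReal ((‖x‖ * ‖f‖) ^ 2) := by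
    rw [mul_pow, ENNReal.ofReal_mul (by positivity), norm_sq_eq_tsum_ennreal,
      norm_sq_eq_tsum_ennreal f, ← (Equiv.sigmaFiberEquiv π).tsum_eq,
      ← (Equiv.sigmaFiberEquiv π).tsum_eq (fun g => ENNReal.ofReal (‖f g‖ ^ 2)),
      ENNReal.tsum_sigma', ENNReal.tsum_sigma', ← ENNReal.tsum_mul_left]
    -- Both squared norms split over the fibres of `π`. On the fibre over `k`, `T f` agrees with `x
    -- p`, where `p` is the part of `f` on that fibre, so one fibre contributes at most `‖x‖² ‖p‖²`.
    refine ENNReal.tsum_le_tsum fun k => ?_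
    set p := indicatorOp (π ⁻¹' {k}) f with hp
    have h1 : ∀ a : {a // π a = k}, T f a.1 = x p a.1 := by
      rintro ⟨a, rfl⟩
      exact h f a
    have h2 : ∑' a : {a // π a = k}, ENNReal.ofReal (‖f a.1‖ ^ 2) = ENNReal.ofReal (‖p‖ ^ 2) := by
      rw [norm_sq_eq_tsum_ennreal p]
      refine (tsum_subtype (π ⁻¹' {k}) (fun g => ENNReal.ofReal (‖f g‖ ^ 2))).trans
        (tsum_congr fun g => ?_)
      rw [hp, indicatorOp_apply]
      by_cases hg : g ∈ π ⁻¹' {k} <;> simp [hg]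
    calc ∑' a : {a // π a = k}, ENNReal.ofReal (‖T f a.1‖ ^ 2)
        = ∑' a : {a // π a = k}, ENNReal.ofReal (‖x p a.1‖ ^ 2) :=
          tsum_congr fun a => by rw [h1]
      _ ≤ ∑' g, ENNReal.ofReal (‖x p g‖ ^ 2) :=
          ENNReal.tsum_comp_le_tsum_of_injective Subtype.val_injective
            (fun g => ENNReal.ofReal (‖x p g‖ ^ 2))
      _ = ENNReal.ofReal (‖x p‖ ^ 2) := (norm_sq_eq_tsum_ennreal _).symm
      _ ≤ ENNReal.ofReal (‖x‖ ^ 2 * ‖p‖ ^ 2) := by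
          rw [← mul_pow]
          exact ENNReal.ofReal_le_ofReal (pow_le_pow_left₀ (norm_nonneg _) (x.le_opNorm p) 2)
      _ = ENNReal.ofReal (‖x‖ ^ 2) * ∑' a : {a // π a = k}, ENNReal.ofReal (‖f a.1‖ ^ 2) := by
          rw [ENNReal.ofReal_mul (by positivity), h2]
  rw [ENNReal.ofReal_le_ofReal_iff (by positivity)] at key
  exact le_of_sq_le_sq key (by positivity)

end Basis

/-! ### Limits in the weak topologies -/

section Weak

variable {H : Type*} [NormedAddCommGroup H] [InnerProductSpace ℂ H]

/-- A matrix coefficient is the defining functional for two sequences concentrated at index `0`. -/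
theorem continuous_weakStar_inner (ξ η : H) :
    @Continuous _ _ (weakStarTopology H) _ fun T : H →L[ℂ] H => ⟪ξ, T η⟫_ℂ := by
  have h : (fun T : H →L[ℂ] H => ⟪ξ, T η⟫_ℂ) = fun T : H →L[ℂ] H =>
      ∑' n, ⟪(lp.single 2 0 ξ : lp (fun _ : ℕ => H) 2) n,
        T ((lp.single 2 0 η : lp (fun _ : ℕ => H) 2) n)⟫_ℂ := by
    funext T
    rw [tsum_eq_single 0]
    · simp
    · intro n hn
      simp [hn]
  rw [h]
  refine continuous_iInf_dom (i := lp.single 2 0 ξ) (continuous_iInf_dom (i := lp.single 2 0 η) ?_)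
  exact continuous_induced_dom

/-- Linearity passes from `S` to its span, and the uniform bound on `v` controls the error of
approximating `ξ` from the span. -/
theorem tendsto_inner_zero_of_dense {ι : Type*} {l : Filter ι} {S : Set H}
    (hS : Dense (Submodule.span ℂ S : Set H)) {v : ι → H} {D : ℝ} (hD : ∀ i, ‖v i‖ ≤ D)
    (h : ∀ ξ ∈ S, Tendsto (fun i => ⟪ξ, v i⟫_ℂ) l (𝓝 0)) (ξ : H) :
    Tendsto (fun i => ⟪ξ, v i⟫_ℂ) l (𝓝 0) := by
  have hspan : ∀ ξ ∈ Submodule.span ℂ S, Tendsto (fun i => ⟪ξ, v i⟫_ℂ) l (𝓝 0) := by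
    intro ξ hξ
    induction hξ using Submodule.span_induction with
    | mem ξ hξ => exact h ξ hξ
    | zero => simpa using tendsto_const_nhds
    | add ξ ξ' _ _ h1 h2 => simpa [inner_add_left] using h1.add h2
    | smul c ξ _ h1 => simpa [inner_smul_left, mul_comm] using h1.const_mul (starRingEnd ℂ c)
  rw [Metric.tendsto_nhds]
  intro ε hε
  have hD' : 0 < |D| + 1 := by positivity
  obtain ⟨ξ', hξ', hd⟩ := Metric.dense_iff.1 hS ξ (ε / 2 / (|D| + 1)) (by positivity)
  filter_upwards [Metric.tendsto_nhds.1 (hspan ξ' hd) (ε / 2) (by positivity)] with i hi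
  rw [dist_zero_right] at hi ⊢
  have h1 : ‖⟪ξ - ξ', v i⟫_ℂ‖ ≤ ε / 2 := by
    rw [Metric.mem_ball, dist_comm, dist_eq_norm] at hξ'
    calc ‖⟪ξ - ξ', v i⟫_ℂ‖ ≤ ‖ξ - ξ'‖ * ‖v i‖ := norm_inner_le_norm _ _
      _ ≤ ε / 2 / (|D| + 1) * (|D| + 1) := by
          gcongr
          linarith [hD i, le_abs_self D]
      _ = ε / 2 := by field_simp
  calc ‖⟪ξ, v i⟫_ℂ‖ = ‖⟪ξ - ξ', v i⟫_ℂ + ⟪ξ', v i⟫_ℂ‖ := by rw [← inner_add_left, sub_add_cancel]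
    _ ≤ _ := norm_add_le _ _
    _ < ε := by linarith

/-- The two vectors are freed one at a time: first `ξ` with `η` in `S`, then `η` by passing to
adjoints, which obey the same norm bound. -/
theorem tendsto_inner_of_dense [CompleteSpace H] {ι : Type*} {l : Filter ι} {S : Set H}
    (hS : Dense (Submodule.span ℂ S : Set H)) {T : ι → H →L[ℂ] H} {x : H →L[ℂ] H} {C : ℝ}
    (hC : ∀ i, ‖T i‖ ≤ C)
    (h : ∀ ξ ∈ S, ∀ η ∈ S, Tendsto (fun i => ⟪ξ, T i η⟫_ℂ) l (𝓝 ⟪ξ, x η⟫_ℂ)) (ξ η : H) :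
    Tendsto (fun i => ⟪ξ, T i η⟫_ℂ) l (𝓝 ⟪ξ, x η⟫_ℂ) := by
  have hb : ∀ i, ‖T i - x‖ ≤ C + ‖x‖ := fun i =>
    (norm_sub_le _ _).trans (by linarith [hC i])
  have h1 : ∀ η ∈ S, ∀ ξ, Tendsto (fun i => ⟪ξ, (T i - x) η⟫_ℂ) l (𝓝 0) := fun η hη =>
    tendsto_inner_zero_of_dense hS (fun i => (T i - x).le_of_opNorm_le (hb i) η) fun ξ hξ => by
      simpa [inner_sub_right] using (h ξ hξ η hη).sub_const ⟪ξ, x η⟫_ℂ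
  have h2 : Tendsto (fun i => ⟪η, star (T i - x) ξ⟫_ℂ) l (𝓝 0) :=
    tendsto_inner_zero_of_dense hS
      (fun i => (star (T i - x)).le_of_opNorm_le (by rw [norm_star]; exact hb i) ξ)
      (fun η hη => by
        have := (Complex.continuous_conj.tendsto _).comp (h1 η hη ξ)
        rw [map_zero] at this
        refine this.congr fun i => ?_
        rw [Function.comp_apply, inner_conj_symm, ContinuousLinearMap.star_eq_adjoint,
          ContinuousLinearMap.adjoint_inner_right]) η
  have h3 := (Complex.continuous_conj.tendsto _).comp h2
  rw [map_zero] at h3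
  have h4 := h3.add_const ⟪ξ, x η⟫_ℂ
  rw [zero_add] at h4
  refine h4.congr fun i => ?_
  rw [Function.comp_apply, inner_conj_symm, ContinuousLinearMap.star_eq_adjoint,
    ContinuousLinearMap.adjoint_inner_left, sub_apply, inner_sub_right,
    sub_add_cancel]

/-- On bounded sequences, convergence of matrix coefficients suffices: by Hölder `∑ ‖ξₙ‖ ‖ηₙ‖` is
finite, so dominated convergence applies to the series defining the weak* functionals. -/
theorem tendsto_weakStar_of_bounded {T : ℕ → H →L[ℂ] H} {x : H →L[ℂ] H} {C : ℝ}
    (hC : ∀ i, ‖T i‖ ≤ C)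
    (h : ∀ ξ η, Tendsto (fun i => ⟪ξ, T i η⟫_ℂ) atTop (𝓝 ⟪ξ, x η⟫_ℂ)) :
    Tendsto T atTop (@nhds _ (weakStarTopology H) x) := by
  simp only [nhds_iInf, nhds_induced, tendsto_iInf, tendsto_comap_iff]
  intro ξ η
  have h2 : (2 : ℝ).HolderConjugate 2 := by constructor <;> norm_num
  have h2' : 0 < (2 : ENNReal).toReal := by norm_num
  have hsum : Summable fun n => ‖ξ n‖ * ‖η n‖ := by
    have h1 := (memℓp_gen_iff h2').1 (lp.memℓp ξ)
    have h3 := (memℓp_gen_iff h2').1 (lp.memℓp η)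
    exact Real.summable_mul_of_Lp_Lq_of_nonneg h2 (fun _ => norm_nonneg _) (fun _ => norm_nonneg _)
      (by simpa using h1) (by simpa using h3)
  refine tendsto_tsum_of_dominated_convergence (bound := fun n => C * (‖ξ n‖ * ‖η n‖))
    (hsum.mul_left C) (fun n => h _ _) (Eventually.of_forall fun i n => ?_)
  calc ‖⟪ξ n, T i (η n)⟫_ℂ‖ ≤ ‖ξ n‖ * ‖T i (η n)‖ := norm_inner_le_norm _ _
    _ ≤ ‖ξ n‖ * (C * ‖η n‖) := by
        gcongr
        exact (T i).le_of_opNorm_le (hC i) _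
    _ = C * (‖ξ n‖ * ‖η n‖) := by ring

variable [CompleteSpace H]

/-- Bounded families of operators converge weakly along ultrafilters. -/
theorem exists_weak_ultralimit {ι : Type*} (F : Ultrafilter ι) (T : ι → H →L[ℂ] H) (C : ℝ)
    (hC : ∀ i, ‖T i‖ ≤ C) :
    ∃ x : H →L[ℂ] H, ∀ ξ η, Tendsto (fun i => ⟪ξ, T i η⟫_ℂ) F (𝓝 ⟪ξ, x η⟫_ℂ) := by
  have hb : ∀ i ξ η, ‖⟪T i η, ξ⟫_ℂ‖ ≤ C * ‖η‖ * ‖ξ‖ := fun i ξ η =>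
    (norm_inner_le_norm _ _).trans (by gcongr; exact (T i).le_of_opNorm_le (hC i) _)
  have hex : ∀ η ξ : H, ∃ c : ℂ, ‖c‖ ≤ C * ‖η‖ * ‖ξ‖ ∧
      Tendsto (fun i => ⟪T i η, ξ⟫_ℂ) F (𝓝 c) := by
    intro η ξ
    -- The matrix coefficients lie in a compact disc, so they converge along the ultrafilter. The
    -- limits form a bounded sesquilinear form, which is represented by an operator.
    obtain ⟨c, hc, hc'⟩ := (isCompact_closedBall (0 : ℂ) (C * ‖η‖ * ‖ξ‖)).ultrafilter_le_nhds
      (F.map fun i => ⟪T i η, ξ⟫_ℂ) (by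
        rw [le_principal_iff, Ultrafilter.mem_coe, Ultrafilter.mem_map]
        exact Filter.univ_mem' fun i => by simpa using hb i ξ η)
    exact ⟨c, by simpa using hc, hc'⟩
  choose B hB hlim using hex
  let B' : H →L⋆[ℂ] H →L[ℂ] ℂ := LinearMap.mkContinuous₂
    (LinearMap.mk₂'ₛₗ (starRingEnd ℂ) (RingHom.id ℂ) B
      (fun η η' ξ => tendsto_nhds_unique (hlim _ _)
        (by simpa [inner_add_left] using (hlim η ξ).add (hlim η' ξ)))
      (fun c η ξ => tendsto_nhds_unique (hlim _ _)
        (by simpa [inner_smul_left, mul_comm] using (hlim η ξ).const_mul ((starRingEnd ℂ) c)))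
      (fun η ξ ξ' => tendsto_nhds_unique (hlim _ _)
        (by simpa [inner_add_right] using (hlim η ξ).add (hlim η ξ')))
      (fun c η ξ => tendsto_nhds_unique (hlim _ _)
        (by simpa [inner_smul_right] using (hlim η ξ).const_mul c))) C
    (fun η ξ => hB η ξ)
  refine ⟨InnerProductSpace.continuousLinearMapOfBilin B', fun ξ η => ?_⟩
  have h : ⟪InnerProductSpace.continuousLinearMapOfBilin B' η, ξ⟫_ℂ = B η ξ :=
    InnerProductSpace.continuousLinearMapOfBilin_apply B' η ξ
  rw [← inner_conj_symm, h]
  exact ((Complex.continuous_conj.tendsto _).comp (hlim η ξ)).congr fun i => inner_conj_symm _ _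

theorem isClosed_weakStar_commute (T : H →L[ℂ] H) :
    @IsClosed _ (weakStarTopology H) {x | T * x = x * T} := by
  have h : {x : H →L[ℂ] H | T * x = x * T} =
      ⋂ (ξ : H) (η : H), {x | ⟪star T ξ, x η⟫_ℂ = ⟪ξ, x (T η)⟫_ℂ} := by
    ext x
    simp only [Set.mem_ofPred_eq, Set.mem_iInter, ContinuousLinearMap.star_eq_adjoint,
      ContinuousLinearMap.adjoint_inner_left]
    refine ⟨fun hx ξ η => ?_, fun hx => ?_⟩
    · exact congrArg (fun S : H →L[ℂ] H => ⟪ξ, S η⟫_ℂ) hx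
    · ext η
      exact ext_inner_left ℂ fun ξ => hx ξ η
  rw [h]
  let := weakStarTopology H
  exact isClosed_iInter fun ξ => isClosed_iInter fun η =>
    isClosed_eq (continuous_weakStar_inner _ _) (continuous_weakStar_inner _ _)

end Weak

/-! ### The regular representations and the group von Neumann algebra -/

section Group

variable {G : Type*} [Group G]

theorem leftReg_apply (g : G) (f : L2 G) (x : G) : leftReg G g f x = f (g⁻¹ * x) := rfl

theorem star_leftReg (g : G) : star (leftReg G g) = leftReg G g⁻¹ := by
  rw [ContinuousLinearMap.star_eq_adjoint]
  refine ((ContinuousLinearMap.eq_adjoint_iff _ _).2 fun ξ η => ?_).symm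
  have h : leftReg G g (leftReg G g⁻¹ ξ) = ξ := by
    rw [← mul_apply_eq_comp, ← map_mul, mul_inv_cancel, map_one]
    rfl
  conv_rhs => rw [← h]
  exact ((compPerm (Equiv.mulLeft g⁻¹)).inner_map_map _ _).symm

theorem leftReg_mul_inv (g : G) : leftReg G g * leftReg G g⁻¹ = 1 := by
  rw [← map_mul, mul_inv_cancel, map_one]

theorem leftReg_inv_mul (g : G) : leftReg G g⁻¹ * leftReg G g = 1 := by
  rw [← map_mul, inv_mul_cancel, map_one]

theorem leftReg_mem_unitary (g : G) : leftReg G g ∈ unitary (L2 G →L[ℂ] L2 G) := by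
  rw [Unitary.mem_iff, star_leftReg]
  exact ⟨leftReg_inv_mul g, leftReg_mul_inv g⟩

theorem leftReg_injective : Function.Injective (leftReg G) := fun g h hgh => by
  have := congrArg (fun T : L2 G →L[ℂ] L2 G => T (delta 1)) hgh
  simp only [leftReg_delta, mul_one] at this
  exact delta_injective this

/-- The right translation `(ρ_g f)(x) = f (x g)`. -/
def rightReg (g : G) : L2 G →L[ℂ] L2 G := (compPerm (Equiv.mulRight g)).toContinuousLinearMap

theorem rightReg_apply (g : G) (f : L2 G) (x : G) : rightReg g f x = f (x * g) := rfl

theorem rightReg_delta (g h : G) : rightReg g (delta h) = delta (h * g⁻¹) := by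
  classical
  ext x
  rw [rightReg_apply, delta_apply, delta_apply]
  simp only [eq_mul_inv_iff_mul_eq]

theorem rightReg_mul_leftReg (g h : G) : rightReg g * leftReg G h = leftReg G h * rightReg g := by
  ext f x
  change f (h⁻¹ * (x * g)) = f (h⁻¹ * x * g)
  rw [mul_assoc]

theorem mem_groupVN_iff {x : L2 G →L[ℂ] L2 G} :
    x ∈ groupVN G ↔ ∀ T : L2 G →L[ℂ] L2 G, (∀ g, leftReg G g * T = T * leftReg G g) →
      T * x = x * T := by
  have hiff : ∀ T : L2 G →L[ℂ] L2 G, T ∈ StarSubalgebra.centralizer ℂ (Set.range (leftReg G)) ↔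
      ∀ g, leftReg G g * T = T * leftReg G g := by
    intro T
    rw [StarSubalgebra.mem_centralizer_iff]
    refine ⟨fun h g => (h _ ⟨g, rfl⟩).1, ?_⟩
    rintro h _ ⟨g, rfl⟩
    exact ⟨h g, by rw [star_leftReg, h]⟩
  change x ∈ StarSubalgebra.centralizer ℂ
    (StarSubalgebra.centralizer ℂ (Set.range (leftReg G)) : Set (L2 G →L[ℂ] L2 G)) ↔ _
  rw [StarSubalgebra.mem_centralizer_iff]
  refine ⟨fun h T hT => (h T ((hiff T).2 hT)).1, fun h T hT => ⟨h T ((hiff T).1 hT), ?_⟩⟩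
  exact h _ ((hiff _).1 (star_mem hT))

theorem rightReg_commute {x : L2 G →L[ℂ] L2 G} (hx : x ∈ groupVN G) (g : G) :
    rightReg g * x = x * rightReg g :=
  mem_groupVN_iff.1 hx _ fun h => (rightReg_mul_leftReg g h).symm

/-- Elements of `L(G)` commute with right translations, and `δ_h` is a right translate of `δ_1`;
hence the matrix of `x` depends only on `g h⁻¹`. -/
theorem apply_delta_apply {x : L2 G →L[ℂ] L2 G} (hx : x ∈ groupVN G) (h g : G) :
    x (delta h) g = fourierCoeff x (g * h⁻¹) := by
  have h1 : (delta h : L2 G) = rightReg h⁻¹ (delta 1) := by simp [rightReg_delta]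
  rw [h1, ← mul_apply_eq_comp, ← rightReg_commute hx, mul_apply_eq_comp,
    rightReg_apply, fourierCoeff]

theorem eq_zero_of_apply_delta_one {x : L2 G →L[ℂ] L2 G} (hx : x ∈ groupVN G)
    (h : x (delta 1) = 0) : x = 0 := by
  refine ext_delta fun g => ?_
  ext k
  rw [apply_delta_apply hx, fourierCoeff, h]
  rfl

theorem trace_eq_fourierCoeff (x : L2 G →L[ℂ] L2 G) : trace x = fourierCoeff x 1 :=
  inner_delta_left _ _

theorem fourierCoeff_leftReg_self (g : G) : fourierCoeff (leftReg G g) g = 1 := by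
  rw [fourierCoeff, leftReg_delta, mul_one, delta_apply_self]

theorem fourierCoeff_leftReg_ne {g h : G} (hne : h ≠ g) : fourierCoeff (leftReg G g) h = 0 := by
  rw [fourierCoeff, leftReg_delta, mul_one, delta_apply_ne hne]

/-- `τ(u_g x u_g*) = τ(x)`. -/
theorem trace_leftReg_conj {x : L2 G →L[ℂ] L2 G} (hx : x ∈ groupVN G) (g : G) :
    trace (leftReg G g * x * star (leftReg G g)) = trace x := by
  rw [trace_eq_fourierCoeff, trace_eq_fourierCoeff, fourierCoeff, star_leftReg,
    mul_apply_eq_comp, mul_apply_eq_comp, leftReg_apply, leftReg_delta,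
    apply_delta_apply hx]
  simp

theorem eq_zero_of_trace_mul_star {x : L2 G →L[ℂ] L2 G} (hx : x ∈ groupVN G)
    (h : trace (x * star x) = 0) : x = 0 := by
  rw [trace, mul_apply_eq_comp, ← ContinuousLinearMap.adjoint_inner_left,
    ← ContinuousLinearMap.star_eq_adjoint, inner_self_eq_zero] at h
  exact star_eq_zero.1 (eq_zero_of_apply_delta_one (star_mem hx) h)

/-- The Fourier coefficients of elements of `L(N)` are supported on `N`. -/
theorem fourierCoeff_eq_zero_of_mem_subgroupVN {N : Subgroup G} {x : L2 G →L[ℂ] L2 G}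
    (hx : x ∈ subgroupVN N) {g : G} (hg : g ∉ N) : fourierCoeff x g = 0 := by
  classical
  -- The projection onto functions supported on `N` commutes with the generators of `L(N)`, hence
  -- with `x`; since it fixes `δ_1`, the vector `x δ_1` is supported on `N`.
  set p : L2 G →L[ℂ] L2 G := indicatorOp (N : Set G) with hp
  have hcomm : ∀ h ∈ N, leftReg G h * p = p * leftReg G h := by
    intro h hh
    ext f k
    rw [mul_apply_eq_comp, mul_apply_eq_comp, leftReg_apply, hp,
      indicatorOp_apply, indicatorOp_apply, Set.indicator_apply, Set.indicator_apply, leftReg_apply]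
    simp only [SetLike.mem_coe, N.mul_mem_cancel_left (N.inv_mem hh)]
  have hpx : p * x = x * p := by
    refine ((StarSubalgebra.mem_centralizer_iff ℂ).1 hx p ?_).1
    rw [SetLike.mem_coe, StarSubalgebra.mem_centralizer_iff]
    rintro _ ⟨h, hh, rfl⟩
    refine ⟨hcomm h hh, ?_⟩
    rw [star_leftReg]
    exact hcomm _ (N.inv_mem hh)
  have h1 : p (delta 1) = delta 1 := by
    rw [hp, indicatorOp, mulOp_delta]
    simp
  rw [fourierCoeff, ← h1, ← mul_apply_eq_comp, ← hpx, mul_apply_eq_comp,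
    hp, indicatorOp_apply]
  exact Set.indicator_of_notMem hg _

theorem leftReg_mem_subgroupVN {N : Subgroup G} {g : G} (hg : g ∈ N) :
    leftReg G g ∈ subgroupVN N :=
  subset_vnGenerated _ ⟨g, hg, rfl⟩

/-- The relative commutant `L(G) ∩ S'` of a self-adjoint set `S`. -/
def relCommutant (S : Set (L2 G →L[ℂ] L2 G)) : VonNeumannAlgebra (L2 G) where
  toStarSubalgebra := StarSubalgebra.centralizer ℂ
    ((StarSubalgebra.centralizer ℂ (Set.range (leftReg G)) : Set (L2 G →L[ℂ] L2 G)) ∪ S)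
  centralizer_centralizer' := by
    change Set.centralizer (Set.centralizer (Set.centralizer _)) = Set.centralizer _
    rw [Set.centralizer_centralizer_centralizer]

theorem mem_relCommutant_iff {S : Set (L2 G →L[ℂ] L2 G)} {x : L2 G →L[ℂ] L2 G} :
    x ∈ relCommutant S ↔ x ∈ groupVN G ∧ ∀ T ∈ S, T * x = x * T ∧ star T * x = x * star T := by
  change x ∈ StarSubalgebra.centralizer ℂ _ ↔ x ∈ StarSubalgebra.centralizer ℂ _ ∧ _
  simp only [StarSubalgebra.mem_centralizer_iff, Set.mem_union, or_imp, forall_and]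
  tauto

theorem isClosed_relCommutant (S : Set (L2 G →L[ℂ] L2 G)) :
    @IsClosed _ (weakStarTopology (L2 G)) (relCommutant S : Set (L2 G →L[ℂ] L2 G)) := by
  let := weakStarTopology (L2 G)
  have h : (relCommutant S : Set (L2 G →L[ℂ] L2 G)) =
      ⋂ T ∈ ((StarSubalgebra.centralizer ℂ (Set.range (leftReg G)) : Set (L2 G →L[ℂ] L2 G)) ∪ S),
        {x | T * x = x * T} ∩ {x | star T * x = x * star T} := by
    ext x
    rw [Set.mem_iInter₂]
    exact StarSubalgebra.mem_centralizer_iff ℂ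
  rw [h]
  exact isClosed_biInter fun T _ =>
    (isClosed_weakStar_commute T).inter (isClosed_weakStar_commute (star T))

end Group

/-! ### Trace-preserving conditional expectations -/

section CondExp

variable {G : Type*} [Group G]

/-- Trace-preserving conditional expectations are unique. -/
theorem IsTraceCondExp.unique {M : VonNeumannAlgebra (L2 G)} {hM : M ≤ groupVN G}
    {E E' : (groupVN G).toStarSubalgebra →ₗ[ℂ] M.toStarSubalgebra}
    (hE : IsTraceCondExp hM E) (hE' : IsTraceCondExp hM E') : E' = E := by
  ext1 x
  set y : M.toStarSubalgebra := E' x - E x with hy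
  -- For any such expectation `F`, `τ(F(x) y*) = τ(F(x y*)) = τ(x y*)`, independently of `F`. With
  -- `y = E' x - E x` this yields `τ(y y*) = 0`, and `τ` is faithful.
  have hb : ∀ {F : (groupVN G).toStarSubalgebra →ₗ[ℂ] M.toStarSubalgebra},
      IsTraceCondExp hM F → trace ((F x).1 * (star y).1) =
        trace (x.1 * (star y).1) := by
    intro F hF
    have h1 := hF.bimodule 1 (star y) x
    have h2 : (⟨(1 : M.toStarSubalgebra).1, hM (1 : M.toStarSubalgebra).2⟩ :
        (groupVN G).toStarSubalgebra) = 1 := rfl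
    rw [h2, one_mul, one_mul] at h1
    have h3 := hF.trace_eq (x * ⟨(star y).1, hM (star y).2⟩)
    rw [h1] at h3
    exact h3
  have h0 : trace (y.1 * star y.1) = 0 := by
    have h1 : y.1 * star y.1 = (E' x).1 * (star y).1 - (E x).1 * (star y).1 := by
      rw [← sub_mul]
      rfl
    have h2 : ∀ S T : L2 G →L[ℂ] L2 G, trace (S - T) = trace S - trace T := fun S T => by
      simp [trace]
    rw [h1, h2, hb hE, hb hE', sub_self]
  have := eq_zero_of_trace_mul_star (hM y.2) h0
  exact sub_eq_zero.1 (Subtype.ext this)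

end CondExp

/-! ### Averages of conjugates -/

section Average

open scoped ComplexOrder

variable {H : Type*} [NormedAddCommGroup H] [InnerProductSpace ℂ H] [CompleteSpace H]

theorem commute_of_tendsto_weak {ι : Type*} {l : Filter ι} [l.NeBot] {T : ι → H →L[ℂ] H}
    {x S : H →L[ℂ] H} (h : ∀ ξ η, Tendsto (fun i => ⟪ξ, T i η⟫_ℂ) l (𝓝 ⟪ξ, x η⟫_ℂ))
    (hT : ∀ᶠ i in l, S * T i = T i * S) : S * x = x * S := by
  ext η
  refine ext_inner_left ℂ fun ξ => ?_
  rw [mul_apply_eq_comp, mul_apply_eq_comp,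
    ← ContinuousLinearMap.adjoint_inner_left]
  refine tendsto_nhds_unique (h _ _) ((h ξ (S η)).congr' ?_)
  filter_upwards [hT] with i hi
  rw [ContinuousLinearMap.adjoint_inner_left, ← mul_apply_eq_comp, ← hi]
  rfl

/-- The average of the conjugates `W i * x * (W i)*`, `i ∈ F`. -/
def avgConj {ι : Type*} (W : ι → H →L[ℂ] H) (F : Finset ι) :
    (H →L[ℂ] H) →ₗ[ℂ] (H →L[ℂ] H) where
  toFun x := (F.card : ℂ)⁻¹ • ∑ i ∈ F, W i * x * star (W i)
  map_add' x y := by simp [mul_add, add_mul, Finset.sum_add_distrib]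
  map_smul' c x := by
    simp only [mul_smul_comm, smul_mul_assoc, ← Finset.smul_sum, RingHom.id_apply]
    rw [smul_comm]

theorem avgConj_apply {ι : Type*} (W : ι → H →L[ℂ] H) (F : Finset ι) (x : H →L[ℂ] H) :
    avgConj W F x = (F.card : ℂ)⁻¹ • ∑ i ∈ F, W i * x * star (W i) := rfl

theorem avgConj_of_forall_eq {ι : Type*} {W : ι → H →L[ℂ] H} {F : Finset ι} (hF : F.Nonempty)
    {x y : H →L[ℂ] H} (h : ∀ i ∈ F, W i * x * star (W i) = y) : avgConj W F x = y := by
  have : (F.card : ℂ) ≠ 0 := by simpa using hF.ne_empty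
  rw [avgConj_apply, Finset.sum_congr rfl h, Finset.sum_const, ← Nat.cast_smul_eq_nsmul ℂ,
    smul_smul, inv_mul_cancel₀ this, one_smul]

theorem norm_avgConj_le {ι : Type*} {W : ι → H →L[ℂ] H} (hW : ∀ i, W i ∈ unitary (H →L[ℂ] H))
    {F : Finset ι} (hF : F.Nonempty) (x : H →L[ℂ] H) : ‖avgConj W F x‖ ≤ ‖x‖ := by
  have hc : (0 : ℝ) < F.card := by exact_mod_cast hF.card_pos
  rw [avgConj_apply, norm_smul, norm_inv, Complex.norm_natCast, inv_mul_le_iff₀ hc]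
  refine (norm_sum_le _ _).trans ?_
  have : ∀ i ∈ F, ‖W i * x * star (W i)‖ ≤ ‖x‖ := fun i _ => by
    rw [CStarRing.norm_mul_mem_unitary _ (Unitary.star_mem (hW i)),
      CStarRing.norm_mem_unitary_mul _ (hW i)]
  simpa using Finset.sum_le_sum this

theorem avgConj_mul_mul {ι : Type*} {W : ι → H →L[ℂ] H} (F : Finset ι) {a b : H →L[ℂ] H}
    (ha : ∀ i, W i * a = a * W i) (hb : ∀ i, b * star (W i) = star (W i) * b) (x : H →L[ℂ] H) :
    avgConj W F (a * x * b) = a * avgConj W F x * b := by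
  rw [avgConj_apply, avgConj_apply, mul_smul_comm, smul_mul_assoc, Finset.mul_sum, Finset.sum_mul]
  congr 1
  refine Finset.sum_congr rfl fun i _ => ?_
  calc W i * (a * x * b) * star (W i) = (W i * a) * x * (b * star (W i)) := by
        simp only [mul_assoc]
    _ = a * (W i * x * star (W i)) * b := by rw [ha, hb]; simp only [mul_assoc]

theorem avgConj_isPositive {ι : Type*} (W : ι → H →L[ℂ] H) (F : Finset ι) {x : H →L[ℂ] H}
    (hx : x.IsPositive) : (avgConj W F x).IsPositive := by
  rw [avgConj_apply]
  have hsum : (∑ i ∈ F, W i * x * star (W i)).IsPositive := by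
    refine Finset.sum_induction _ _ (fun _ _ => ContinuousLinearMap.IsPositive.add)
      ContinuousLinearMap.isPositive_zero fun i _ => ?_
    exact hx.conj_adjoint (W i)
  exact hsum.smul_of_nonneg (inv_nonneg.2 (Nat.cast_nonneg _))

end Average

/-! ### Weak limits of averages and the trace-preserving expectation. -/

section UltraAverage

open scoped ComplexOrder

variable {H : Type*} [NormedAddCommGroup H] [InnerProductSpace ℂ H] [CompleteSpace H]

/-- The weak limit, along an ultrafilter, of averages of conjugates by unitaries. -/
theorem exists_ultraAvgConj {ι : Type*} {W : ι → H →L[ℂ] H}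
    (hW : ∀ i, W i ∈ unitary (H →L[ℂ] H)) {F : ℕ → Finset ι} (hF : ∀ n, (F n).Nonempty) :
    ∃ Φ : (H →L[ℂ] H) →ₗ[ℂ] (H →L[ℂ] H), ∀ x ξ η,
      Tendsto (fun n => ⟪ξ, avgConj W (F n) x η⟫_ℂ) (hyperfilter ℕ) (𝓝 ⟪ξ, Φ x η⟫_ℂ) := by
  choose Φ hΦ using fun x : H →L[ℂ] H => exists_weak_ultralimit (hyperfilter ℕ)
    (fun n => avgConj W (F n) x) ‖x‖ fun n => norm_avgConj_le hW (hF n) x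
  refine ⟨⟨⟨Φ, fun x y => ?_⟩, fun c x => ?_⟩, hΦ⟩
  · ext η
    refine ext_inner_left ℂ fun ξ => tendsto_nhds_unique (hΦ _ ξ η) ?_
    simpa [inner_add_right] using (hΦ x ξ η).add (hΦ y ξ η)
  · ext η
    refine ext_inner_left ℂ fun ξ => tendsto_nhds_unique (hΦ _ ξ η) ?_
    simpa [inner_smul_right] using (hΦ x ξ η).const_mul c

theorem commute_iff_conj_eq {U : H →L[ℂ] H} (hU : U ∈ unitary (H →L[ℂ] H)) {x : H →L[ℂ] H} :
    U * x = x * U ↔ U * x * star U = x := by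
  refine ⟨fun h => ?_, fun h => ?_⟩
  · rw [h, mul_assoc, Unitary.mul_star_self_of_mem hU, mul_one]
  · conv_rhs => rw [← h]
    rw [mul_assoc _ (star U), Unitary.star_mul_self_of_mem hU, mul_one]

theorem star_commute_of_commute {U : H →L[ℂ] H} (hU : U ∈ unitary (H →L[ℂ] H)) {x : H →L[ℂ] H}
    (h : U * x = x * U) : star U * x = x * star U := by
  calc star U * x = star U * (x * U) * star U := by
        rw [mul_assoc, mul_assoc, Unitary.mul_star_self_of_mem hU, mul_one]
    _ = x * star U := by
        rw [← h, ← mul_assoc, Unitary.star_mul_self_of_mem hU, one_mul]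


/-- The trace-preserving conditional expectation onto the fixed points in `L(G)` of a group of
automorphisms that are implemented by unitaries, as a limit of averages over finite sets. -/
theorem exists_isTraceCondExp {G : Type*} [Group G] {M : VonNeumannAlgebra (L2 G)} {ι : Type*}
    {W : ι → L2 G →L[ℂ] L2 G} (hW : ∀ i, W i ∈ unitary (L2 G →L[ℂ] L2 G))
    (hL : ∀ i, ∀ x ∈ groupVN G, W i * x * star (W i) ∈ groupVN G)
    (htr : ∀ i, ∀ x ∈ groupVN G, trace (W i * x * star (W i)) = trace x)
    (hM : ∀ x, x ∈ M ↔ x ∈ groupVN G ∧ ∀ i, W i * x = x * W i)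
    {F : ℕ → Finset ι} (hF : ∀ n, (F n).Nonempty)
    (hinv : ∀ i x, ∀ᶠ n in atTop, W i * avgConj W (F n) x * star (W i) = avgConj W (F n) x) :
    ∃ (hMG : M ≤ groupVN G) (E : (groupVN G).toStarSubalgebra →ₗ[ℂ] M.toStarSubalgebra),
      IsTraceCondExp hMG E ∧ ∀ x, (∀ n, avgConj W (F n) x.1 = 0) → E x = 0 := by
  have hMG : M ≤ groupVN G := fun x hx => ((hM x).1 hx).1
  obtain ⟨Φ, hΦ⟩ := exists_ultraAvgConj hW hF
  -- A non-principal ultrafilter refines `atTop`, so the eventual invariance of the averages passes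
  -- to their limit `Φ x`.
  have hinf : (hyperfilter ℕ : Filter ℕ) ≤ atTop := Nat.hyperfilter_le_atTop
  have hAL : ∀ n, ∀ x ∈ groupVN G, avgConj W (F n) x ∈ groupVN G := fun n x hx =>
    (groupVN G).toStarSubalgebra.smul_mem
      (sum_mem (S := (groupVN G).toStarSubalgebra) fun i _ => hL i x hx) _
  have hΦL : ∀ x ∈ groupVN G, Φ x ∈ groupVN G := fun x hx =>
    mem_groupVN_iff.2 fun T hT => commute_of_tendsto_weak (hΦ x)
      (Eventually.of_forall fun n => mem_groupVN_iff.1 (hAL n x hx) T hT)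
  have hΦM : ∀ x ∈ groupVN G, Φ x ∈ M := fun x hx =>
    (hM _).2 ⟨hΦL x hx, fun i => commute_of_tendsto_weak (hΦ x)
      (((hinv i x).filter_mono hinf).mono fun n hn => (commute_iff_conj_eq (hW i)).2 hn)⟩
  have hbi : ∀ a ∈ M, ∀ b ∈ M, ∀ x, Φ (a * x * b) = a * Φ x * b := by
    intro a ha b hb x
    refine ContinuousLinearMap.ext fun η => ext_inner_left ℂ fun ξ =>
      tendsto_nhds_unique (hΦ _ ξ η) ?_
    have h := hΦ x (star a ξ) (b η)
    rw [ContinuousLinearMap.star_eq_adjoint, ContinuousLinearMap.adjoint_inner_left] at h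
    refine h.congr fun n => ?_
    rw [avgConj_mul_mul (F n) ((hM a).1 ha).2
      (fun i => (star_commute_of_commute (hW i) (((hM b).1 hb).2 i)).symm) x,
      ContinuousLinearMap.adjoint_inner_left]
    rfl
  have hfix : ∀ a ∈ M, Φ a = a := by
    intro a ha
    refine ContinuousLinearMap.ext fun η => ext_inner_left ℂ fun ξ =>
      tendsto_nhds_unique (hΦ _ ξ η) ?_
    refine tendsto_const_nhds.congr fun n => ?_
    rw [avgConj_of_forall_eq (hF n) fun i _ => (commute_iff_conj_eq (hW i)).1 (((hM a).1 ha).2 i)]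
  refine ⟨hMG, ⟨⟨fun x => ⟨Φ x.1, hΦM x.1 x.2⟩, fun x y => Subtype.ext (map_add Φ x.1 y.1)⟩,
    fun c x => Subtype.ext (map_smul Φ c x.1)⟩, ⟨?_, ?_, ?_, ?_⟩, ?_⟩
  · exact fun m => Subtype.ext (hfix m.1 m.2)
  · exact fun a b x => Subtype.ext (hbi a.1 a.2 b.1 b.2 x.1)
  · intro x hx
    change (Φ x.1).IsPositive
    have hn : ∀ n η, 0 ≤ ⟪η, avgConj W (F n) x.1 η⟫_ℂ := fun n η =>
      (avgConj_isPositive W (F n) hx).inner_nonneg_right η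
    rw [ContinuousLinearMap.isPositive_iff_complex]
    intro η
    have h0 : 0 ≤ ⟪η, Φ x.1 η⟫_ℂ := ge_of_tendsto' (hΦ x.1 η η) fun n => hn n η
    have h1 : ⟪Φ x.1 η, η⟫_ℂ = ⟪η, Φ x.1 η⟫_ℂ := by
      rw [← inner_conj_symm]
      exact Complex.conj_eq_iff_im.2 (Complex.nonneg_iff.1 h0).2.symm
    rw [h1]
    have h2 := Complex.nonneg_iff.1 h0
    exact ⟨Complex.ext rfl h2.2, h2.1⟩
  · intro x
    change trace (Φ x.1) = trace x.1
    refine tendsto_nhds_unique (hΦ x.1 (delta 1) (delta 1)) (tendsto_const_nhds.congr fun n => ?_)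
    have hc : ((F n).card : ℂ) ≠ 0 := by simpa using (hF n).ne_empty
    have hs := Finset.sum_congr rfl fun i (_ : i ∈ F n) => htr i x.1 x.2
    rw [Finset.sum_const, nsmul_eq_mul] at hs
    rw [avgConj_apply, smul_apply, inner_smul_right, sum_apply, inner_sum]
    exact ((eq_inv_mul_iff_mul_eq₀ hc).2 hs.symm)
  · intro x hx
    refine Subtype.ext ?_
    change Φ x.1 = 0
    refine ContinuousLinearMap.ext fun η => ext_inner_left ℂ fun ξ =>
      tendsto_nhds_unique (hΦ x.1 ξ η) ?_
    simp [hx]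

end UltraAverage

/-! ### Signs of finite permutations -/

section Sign

open scoped Classical in
/-- The sign of the restriction of `s` to an invariant finite set `K`. -/
def signOn (s : Equiv.Perm ℕ) (K : Finset ℕ) : ℤˣ :=
  if h : ∀ n, s n ∈ K ↔ n ∈ K then
    Equiv.Perm.sign (s.subtypePerm (p := fun n => n ∈ K) h) else 1

theorem signOn_of_preserves {s : Equiv.Perm ℕ} {K : Finset ℕ} (h : ∀ n, s n ∈ K ↔ n ∈ K) :
    signOn s K = Equiv.Perm.sign (s.subtypePerm (p := fun n => n ∈ K) h) := dif_pos h

theorem signOn_mul {s t : Equiv.Perm ℕ} {K : Finset ℕ} (hs : ∀ n, s n ∈ K ↔ n ∈ K)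
    (ht : ∀ n, t n ∈ K ↔ n ∈ K) : signOn (s * t) K = signOn s K * signOn t K := by
  have hst : ∀ n, (s * t) n ∈ K ↔ n ∈ K := fun n => (hs _).trans (ht n)
  rw [signOn_of_preserves hs, signOn_of_preserves ht, signOn_of_preserves hst,
    ← Equiv.Perm.sign_mul]
  congr 1

theorem signOn_of_fixed {s : Equiv.Perm ℕ} {K : Finset ℕ} (h : ∀ n ∈ K, s n = n) :
    signOn s K = 1 := by
  by_cases hK : ∀ n, s n ∈ K ↔ n ∈ K
  · rw [signOn_of_preserves hK]
    convert! Equiv.Perm.sign_one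
    ext ⟨n, hn⟩
    exact h n hn
  · exact dif_neg hK

theorem signOn_union {s : Equiv.Perm ℕ} {A B : Finset ℕ} (hAB : Disjoint A B)
    (hA : ∀ n, s n ∈ A ↔ n ∈ A) (hB : ∀ n, s n ∈ B ↔ n ∈ B) :
    signOn s (A ∪ B) = signOn s A * signOn s B := by
  have hU : ∀ n, s n ∈ A ∪ B ↔ n ∈ A ∪ B := fun n => by simp [hA, hB]
  rw [signOn_of_preserves hA, signOn_of_preserves hB, signOn_of_preserves hU,
    ← Equiv.Perm.sign_sumCongr]
  refine (Equiv.Perm.sign_eq_sign_of_equiv _ _ (Equiv.Finset.union A B hAB) ?_).symm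
  rintro (x | x) <;> rfl

/-- This identifies the product of the signs on the parts of a partition with the sign of the whole
permutation. -/
theorem signOn_biUnion {s : Equiv.Perm ℕ} {F : Finset (Finset ℕ)}
    (hd : (F : Set (Finset ℕ)).PairwiseDisjoint id)
    (hF : ∀ K ∈ F, ∀ n, s n ∈ K ↔ n ∈ K) : signOn s (F.biUnion id) = ∏ K ∈ F, signOn s K := by
  induction F using Finset.induction_on with
  | empty => simpa using signOn_of_fixed (K := ∅) (by simp)
  | insert K F hK ih =>
    rw [Finset.coe_insert] at hd
    have hF' : ∀ L ∈ F, ∀ n, s n ∈ L ↔ n ∈ L := fun L hL => hF L (Finset.mem_insert_of_mem hL)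
    rw [Finset.biUnion_insert, Finset.prod_insert hK, id, signOn_union _
      (hF K (Finset.mem_insert_self _ _)), ih (hd.subset (Set.subset_insert _ _)) hF']
    · intro n
      simp only [Finset.mem_biUnion, id]
      exact exists_congr fun L => and_congr_right fun hL => hF' L hL n
    · rw [Finset.disjoint_biUnion_right]
      intro L hL
      exact hd (Set.mem_insert _ _) (Set.mem_insert_of_mem _ hL) fun h => hK (h ▸ hL)

theorem preserves_of_fixed_compl {s : Equiv.Perm ℕ} {K : Finset ℕ} (h : ∀ n ∉ K, s n = n) (n : ℕ) :
    s n ∈ K ↔ n ∈ K := by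
  refine ⟨fun hn => ?_, fun hn => ?_⟩
  · by_contra hc
    rw [h n hc] at hn
    exact hc hn
  · by_contra hc
    have := s.injective (h _ hc)
    rw [this] at hc
    exact hc hn

/-- Fixed points do not affect the sign; thus any finite set containing the support computes `sgn`,
which makes it multiplicative. -/
theorem signOn_eq_of_subset {s : Equiv.Perm ℕ} {K L : Finset ℕ} (hKL : K ⊆ L)
    (h : ∀ n ∉ K, s n = n) : signOn s L = signOn s K := by
  have hL := preserves_of_fixed_compl fun n hn => h n fun h' => hn (hKL h')
  have hK := preserves_of_fixed_compl h
  have h1 : L = K ∪ L \ K := (Finset.union_sdiff_of_subset hKL).symm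
  rw [h1, signOn_union Finset.disjoint_sdiff hK, signOn_of_fixed (K := L \ K), mul_one]
  · exact fun n hn => h n (Finset.mem_sdiff.1 hn).2
  · intro n
    simp [hK, hL]

theorem finite_support (s : SInf) : {n | s.1 n ≠ n}.Finite := s.2

theorem fixed_of_notMem_support (s : SInf) : ∀ n ∉ (finite_support s).toFinset, s.1 n = n :=
  fun n hn => by
  rw [Set.Finite.mem_toFinset, Set.mem_ofPred_eq, not_not] at hn
  exact hn

theorem signOn_support {s : SInf} {K : Finset ℕ} (h : ∀ n ∉ K, s.1 n = n) :
    signOn s.1 (finite_support s).toFinset = signOn s.1 K := by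
  rw [← signOn_eq_of_subset Finset.subset_union_left (fixed_of_notMem_support s),
    ← signOn_eq_of_subset (L := (finite_support s).toFinset ∪ K) Finset.subset_union_right h]

/-- The sign of a finite permutation of `ℕ`. -/
def sgn : SInf →* ℤˣ where
  toFun s := signOn s.1 (finite_support s).toFinset
  map_one' := signOn_of_fixed fun _ _ => rfl
  map_mul' s t := by
    have hs : ∀ n ∉ (finite_support s).toFinset ∪ (finite_support t).toFinset, s.1 n = n :=
      fun n hn =>
      fixed_of_notMem_support s n fun h => hn (Finset.mem_union_left _ h)
    have ht : ∀ n ∉ (finite_support s).toFinset ∪ (finite_support t).toFinset, t.1 n = n :=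
      fun n hn =>
      fixed_of_notMem_support t n fun h => hn (Finset.mem_union_right _ h)
    rw [signOn_support hs, signOn_support ht,
      signOn_support (K := (finite_support s).toFinset ∪ (finite_support t).toFinset)]
    · exact signOn_mul (preserves_of_fixed_compl hs) (preserves_of_fixed_compl ht)
    · intro n hn
      change s.1 (t.1 n) = n
      rw [ht n hn, hs n hn]

theorem sgn_eq_signOn {s : SInf} {K : Finset ℕ} (h : ∀ n ∉ K, s.1 n = n) :
    sgn s = signOn s.1 K := signOn_support h

theorem sgn_transposition {i j : ℕ} (hij : i ≠ j) : sgn (transposition i j) = -1 := by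
  have hfix : ∀ n ∉ ({i, j} : Finset ℕ), Equiv.swap i j n = n := fun n hn => by
    simp only [Finset.mem_insert, Finset.mem_singleton, not_or] at hn
    exact Equiv.swap_apply_of_ne_of_ne hn.1 hn.2
  have hK := preserves_of_fixed_compl hfix
  rw [sgn_eq_signOn (K := {i, j}) hfix]
  change signOn (Equiv.swap i j) _ = -1
  rw [signOn_of_preserves hK]
  have h : (Equiv.swap i j).subtypePerm (p := fun n => n ∈ ({i, j} : Finset ℕ)) hK =
      Equiv.swap ⟨i, by simp⟩ ⟨j, by simp⟩ := by
    ext ⟨n, hn⟩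
    simp only [Equiv.Perm.subtypePerm_apply, Equiv.swap_apply_def, Subtype.mk.injEq]
    split_ifs <;> rfl
  rw [h, Equiv.Perm.sign_swap (by simpa using hij)]

end Sign

/-! ### Characters of `ℤ₂^∞` -/

section Characters

/-- The pairing of `ℤ₂^∞` with its dual group. -/
def pairing (x : ℕ → ℤˣ) : Z2Inf →* ℤˣ where
  toFun v := v.toAdd.prod fun n a => x n ^ a
  map_one' := Finsupp.prod_zero_index
  map_mul' _ _ := Finsupp.prod_add_index' (fun _ => uzpow_zero _) fun _ => uzpow_add _

theorem pairing_apply (x : ℕ → ℤˣ) (v : Z2Inf) :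
    pairing x v = v.toAdd.prod fun n a => x n ^ a := rfl

theorem pairing_one (v : Z2Inf) : pairing 1 v = 1 := by simp [pairing_apply]

theorem pairing_mul (x y : ℕ → ℤˣ) (v : Z2Inf) :
    pairing (x * y) v = pairing x v * pairing y v := by
  simp [pairing_apply, mul_uzpow]

theorem pairing_neg (x : ℕ → ℤˣ) (v : Z2Inf) :
    pairing (-x) v = pairing (-1) v * pairing x v := by
  rw [← pairing_mul, neg_one_mul]

theorem pairing_coord (x : ℕ → ℤˣ) (n : ℕ) (z : Z2) : pairing x (coord n z) = x n ^ z.toAdd :=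
  Finsupp.prod_single_index (uzpow_zero _)

theorem pairing_permAction (x : ℕ → ℤˣ) (s : SInf) (v : Z2Inf) :
    pairing x (permAction s v) = pairing (x ∘ s.1) v :=
  Finsupp.prod_equivMapDomain _ _ _

theorem pairing_congr {x y : ℕ → ℤˣ} {v : Z2Inf} (h : ∀ n, v.toAdd n ≠ 0 → x n = y n) :
    pairing x v = pairing y v :=
  Finsupp.prod_congr fun n hn => by rw [h n (Finsupp.mem_support_iff.1 hn)]

theorem pairing_update (n : ℕ) (v : Z2Inf) :
    pairing (Function.update 1 n (-1)) v = (-1) ^ v.toAdd n := by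
  rw [pairing_apply, Finsupp.prod, Finset.prod_eq_single n]
  · simp
  · intro m _ hm
    simp [hm]
  · intro hn
    rw [Finsupp.notMem_support_iff.1 hn, uzpow_zero]

theorem pairing_separates {v w : Z2Inf} (h : ∀ x, pairing x v = pairing x w) : v = w := by
  have hinj : ∀ a b : ZMod 2, (-1 : ℤˣ) ^ a = (-1) ^ b → a = b := by decide
  refine Multiplicative.toAdd.injective (Finsupp.ext fun n => hinj _ _ ?_)
  rw [← pairing_update, ← pairing_update, h]

/-- The inclusion of the signs in `ℂ`. -/
def signCast : ℤˣ →* ℂ := (Int.castRingHom ℂ).toMonoidHom.comp (Units.coeHom ℤ)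

theorem signCast_apply (u : ℤˣ) : signCast u = ((u : ℤ) : ℂ) := rfl

theorem signCast_injective : Function.Injective signCast := fun _ _ h =>
  Units.ext (Int.cast_injective h)

theorem signCast_neg (u : ℤˣ) : signCast (-u) = -signCast u := by simp [signCast_apply]

theorem signCast_mul_self (u : ℤˣ) : signCast u * signCast u = 1 := by
  rw [← map_mul, Int.units_mul_self, map_one]

theorem norm_signCast (u : ℤˣ) : ‖signCast u‖ = 1 := by
  rcases Int.units_eq_one_or u with rfl | rfl <;> simp [signCast_apply]

theorem star_signCast (u : ℤˣ) : starRingEnd ℂ (signCast u) = signCast u := by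
  simp [signCast_apply]

/-- The evaluation of elements of the group algebra of `ℤ₂^∞` at a character. -/
def evalChar (x : ℕ → ℤˣ) : MonoidAlgebra ℂ Z2Inf →ₐ[ℂ] ℂ :=
  MonoidAlgebra.lift ℂ ℂ Z2Inf (signCast.comp (pairing x))

theorem evalChar_single (x : ℕ → ℤˣ) (v : Z2Inf) (c : ℂ) :
    evalChar x (MonoidAlgebra.single v c) = c * signCast (pairing x v) := by
  simp [evalChar, MonoidAlgebra.lift_single]

/-- Distinct `v` give distinct homomorphisms `x ↦ pairing x v` from `ℕ → {±1}` to `ℂ`, and these are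
linearly independent by Dedekind. -/
theorem evalChar_separates {f f' : MonoidAlgebra ℂ Z2Inf}
    (h : ∀ x, evalChar x f = evalChar x f') : f = f' := by
  let φ : Z2Inf → ((ℕ → ℤˣ) →* ℂ) := fun v =>
    { toFun := fun x => signCast (pairing x v)
      map_one' := by rw [pairing_one, map_one]
      map_mul' := fun x y => by rw [pairing_mul, map_mul] }
  have hφ : Function.Injective φ := fun v w hvw => pairing_separates fun x =>
    signCast_injective (DFunLike.congr_fun hvw x)
  have hli := (linearIndependent_monoidHom (ℕ → ℤˣ) ℂ).comp φ hφ
  rw [← MonoidAlgebra.coeff_inj]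
  refine hli ?_
  ext x
  have := h x
  simp only [evalChar, MonoidAlgebra.lift_apply] at this
  simpa [Finsupp.linearCombination_apply, Finsupp.sum, φ] using this

end Characters

/-! ### The character of `G` and its multiplication operator -/

section Flip

/-- The character `(v, s) ↦ sign(s) (-1)^{|v|}` of `G`. -/
def parity : WreathG →* ℤˣ where
  toFun g := sgn g.right * pairing (-1) g.left
  map_one' := by simp
  map_mul' g h := by
    rw [SemidirectProduct.mul_right, SemidirectProduct.mul_left, map_mul, map_mul,
      pairing_permAction]
    change _ * (_ * pairing (-1) h.left) = _
    exact mul_mul_mul_comm _ _ _ _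

theorem parity_apply (g : WreathG) : parity g = sgn g.right * pairing (-1) g.left := rfl

theorem parity_inl (v : Z2Inf) : parity (SemidirectProduct.inl v) = pairing (-1) v := by
  simp [parity_apply]

theorem parity_inr (s : SInf) : parity (SemidirectProduct.inr s) = sgn s := by
  simp [parity_apply]

/-- The multiplication operator of the character `parity`. -/
def parityOp : L2 WreathG →L[ℂ] L2 WreathG :=
  mulOp (fun g => signCast (parity g)) fun g => (norm_signCast (parity g)).le

theorem parityOp_apply (f : L2 WreathG) (g : WreathG) :
    parityOp f g = signCast (parity g) * f g := rfl

theorem parityOp_mul_self : parityOp * parityOp = 1 := by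
  ext f g
  rw [mul_apply_eq_comp, parityOp_apply, parityOp_apply, ← mul_assoc, signCast_mul_self, one_mul]
  rfl

theorem star_parityOp : star parityOp = parityOp := by
  rw [ContinuousLinearMap.star_eq_adjoint]
  refine ((ContinuousLinearMap.eq_adjoint_iff _ _).2 fun ξ η => ?_).symm
  rw [lp.inner_eq_tsum, lp.inner_eq_tsum]
  refine tsum_congr fun g => ?_
  rw [parityOp_apply, parityOp_apply, RCLike.inner_apply, RCLike.inner_apply, map_mul,
    star_signCast]
  ring

theorem parityOp_mem_unitary : parityOp ∈ unitary (L2 WreathG →L[ℂ] L2 WreathG) := by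
  rw [Unitary.mem_iff, star_parityOp]
  exact ⟨parityOp_mul_self, parityOp_mul_self⟩

theorem parityOp_mul_leftReg (g : WreathG) :
    parityOp * leftReg WreathG g = signCast (parity g) • (leftReg WreathG g * parityOp) := by
  refine ext_delta fun h => ?_
  rw [mul_apply_eq_comp, smul_apply, mul_apply_eq_comp, leftReg_delta, parityOp, mulOp_delta,
    mulOp_delta, map_smul, leftReg_delta, smul_smul, map_mul, map_mul]

theorem parityOp_conj_leftReg (g : WreathG) :
    parityOp * leftReg WreathG g * star parityOp = signCast (parity g) • leftReg WreathG g := by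
  rw [parityOp_mul_leftReg, star_parityOp, smul_mul_assoc, mul_assoc, parityOp_mul_self, mul_one]

/-- Conjugation by `parityOp` only changes each `u_g` by a sign, so it preserves the commutant of
the `u_g`, and therefore the bicommutant `L(G)`. -/
theorem parityOp_conj_mem {x : L2 WreathG →L[ℂ] L2 WreathG} (hx : x ∈ groupVN WreathG) :
    parityOp * x * star parityOp ∈ groupVN WreathG := by
  rw [star_parityOp, mem_groupVN_iff]
  intro T hT
  have h := mem_groupVN_iff.1 hx (parityOp * T * parityOp) fun g => by
    have h1 : leftReg WreathG g * parityOp = signCast (parity g) • (parityOp * leftReg WreathG g) := by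
      rw [parityOp_mul_leftReg, smul_smul, signCast_mul_self, one_smul]
    rw [← mul_assoc, ← mul_assoc, h1, smul_mul_assoc, smul_mul_assoc, mul_assoc parityOp, hT,
      mul_assoc (parityOp * T), parityOp_mul_leftReg, mul_smul_comm]
    simp only [mul_assoc]
  calc T * (parityOp * x * parityOp)
      = parityOp * (parityOp * T * parityOp * x) * parityOp := by
        simp only [← mul_assoc, parityOp_mul_self, one_mul]
    _ = parityOp * x * parityOp * T := by
        rw [h]
        simp only [mul_assoc, parityOp_mul_self, mul_one]

theorem trace_parityOp_conj (x : L2 WreathG →L[ℂ] L2 WreathG) :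
    trace (parityOp * x * star parityOp) = trace x := by
  have h : parityOp (delta 1) = delta 1 := by
    rw [parityOp, mulOp_delta, map_one, map_one, one_smul]
  rw [star_parityOp, trace, mul_apply_eq_comp, mul_apply_eq_comp, h,
    ← ContinuousLinearMap.adjoint_inner_left, ← ContinuousLinearMap.star_eq_adjoint, star_parityOp,
    h, trace]

end Flip

/-! ### The operators in `𝒞` -/

section Blocks

variable (P : L2 Z2 →L[ℂ] L2 Z2) (s : SInf)

/-- The factor `P^K + sign(s|_K) (1 - P)^K`. -/
def block (K : Finset ℕ) : MonoidAlgebra ℂ Z2Inf :=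
  copyOn P K + (signOn s.1 K : ℤ) • copyOn (1 - P) K

theorem block_of_card_le_one {K : Finset ℕ} (h0 : K ≠ ∅) (h1 : K.card ≤ 1)
    (hs : ∀ n, s.1 n ∈ K ↔ n ∈ K) : block P s K = 1 := by
  obtain ⟨n, rfl⟩ := Finset.card_eq_one.1
    (le_antisymm h1 (Finset.card_pos.2 (Finset.nonempty_iff_ne_empty.2 h0)))
  have hn : s.1 n = n := by simpa using hs n
  rw [block, signOn_of_fixed (by simpa using hn), copyOn, copyOn, Finset.prod_singleton,
    Finset.prod_singleton, Units.val_one, one_smul, copyAt_add_copyAt]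

theorem partProduct_eq_prod {𝒦 : Part} (hs : Preserves s 𝒦) {F : Finset (Finset ℕ)}
    (hF : ∀ K ∈ F, K ∈ 𝒦.parts) (hF' : ∀ K ∈ 𝒦.parts, 1 < K.card → K ∈ F) :
    partProduct P s 𝒦 hs = ∏ K ∈ F, block P s K := by
  have h1 : partProduct P s 𝒦 hs = ∏ᶠ K : 𝒦.parts, block P s K := by
    refine finprod_congr fun K => ?_
    rw [block, signOn_of_preserves (hs K.1 K.2)]
  rw [h1, ← finprod_mem_coe_finset]
  refine (finprod_set_coe_eq_finprod_mem (f := block P s) 𝒦.parts).trans ?_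
  refine finprod_mem_inter_mulSupport_eq' _ _ _ fun K hK => ⟨fun hK' => hF' K hK' ?_, hF K⟩
  by_contra hc
  exact hK (block_of_card_le_one P s (fun h => 𝒦.empty_notMem (h ▸ hK')) (not_lt.1 hc) (hs K hK'))

/-- The parts with more than one element suffice: one-point parts contribute the factor `1`, and `s`
fixes their points, so they do not affect the sign either. -/
theorem exists_finset_parts {𝒦 : Part} (hs : Preserves s 𝒦) :
    ∃ F : Finset (Finset ℕ), (∀ K ∈ F, ∀ n, s.1 n ∈ K ↔ n ∈ K) ∧
      partProduct P s 𝒦 hs = ∏ K ∈ F, block P s K ∧ ∏ K ∈ F, signOn s.1 K = sgn s ∧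
      ∀ n, s.1 n = n ∨ ∃ K ∈ F, n ∈ K := by
  set F := 𝒦.finite.toFinset with hFdef
  have hF : ∀ K ∈ F, K ∈ 𝒦.parts := fun K hK => (𝒦.finite.mem_toFinset.1 hK).1
  have hF' : ∀ K ∈ 𝒦.parts, 1 < K.card → K ∈ F := fun K hK hK' =>
    𝒦.finite.mem_toFinset.2 ⟨hK, hK'⟩
  have hpres : ∀ K ∈ F, ∀ n, s.1 n ∈ K ↔ n ∈ K := fun K hK => hs K (hF K hK)
  have hd : (F : Set (Finset ℕ)).PairwiseDisjoint id := fun K hK L hL hne =>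
    Finset.disjoint_left.2 fun n hnK hnL => hne
      ((𝒦.cover n).unique ⟨hF K hK, hnK⟩ ⟨hF L hL, hnL⟩)
  have hfix : ∀ n, s.1 n = n ∨ ∃ K ∈ F, n ∈ K := by
    intro n
    obtain ⟨K, ⟨hK, hn⟩, -⟩ := 𝒦.cover n
    by_cases hc : 1 < K.card
    · exact Or.inr ⟨K, hF' K hK hc, hn⟩
    · exact Or.inl (Finset.card_le_one.1 (not_lt.1 hc) _ ((hs K hK n).2 hn) _ hn)
  refine ⟨F, hpres, partProduct_eq_prod P s hs hF hF', ?_, hfix⟩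
  rw [← signOn_biUnion hd hpres, sgn_eq_signOn]
  intro n hn
  refine (hfix n).resolve_right ?_
  simpa using hn

end Blocks

/-! ### Projections in `L(ℤ₂)` -/

section Projection

/-- The Fourier coefficients of a non-trivial projection in `L(ℤ₂)`. -/
theorem exists_sign_of_projection {P : L2 Z2 →L[ℂ] L2 Z2} (hL : P ∈ groupVN Z2)
    (hP : IsStarProjection P) (h0 : P ≠ 0) (h1 : P ≠ 1) :
    ∃ ε : ℤˣ, fourierCoeff P 1 = 1 / 2 ∧
      fourierCoeff P (Multiplicative.ofAdd 1) = signCast ε / 2 := by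
  set z : Z2 := Multiplicative.ofAdd 1 with hz
  have hcases : ∀ g : Z2, g = 1 ∨ g = z := by decide
  have hne : z ≠ 1 := by decide
  have hzz : z * z⁻¹ = 1 := by decide
  have hz' : (1 : Z2) * z⁻¹ = z := by decide
  set a := fourierCoeff P 1 with ha
  set b := fourierCoeff P z with hb
  have hdelta : P (delta 1) = a • delta 1 + b • delta z := by
    ext g
    rcases hcases g with rfl | rfl
    · change a = a * (delta 1 : L2 Z2) 1 + b * (delta z : L2 Z2) 1
      rw [delta_apply_self, delta_apply_ne hne.symm, mul_one, mul_zero, add_zero]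
    · change b = a * (delta 1 : L2 Z2) z + b * (delta z : L2 Z2) z
      rw [delta_apply_self, delta_apply_ne hne, mul_one, mul_zero, zero_add]
  have hPP : P (P (delta 1)) = P (delta 1) := congrArg (fun T : L2 Z2 →L[ℂ] L2 Z2 => T (delta 1))
    hP.isIdempotentElem
  have hab : ∀ g, a * fourierCoeff P g + b * fourierCoeff P (g * z⁻¹) = fourierCoeff P g := by
    intro g
    have h := congrArg (fun f : L2 Z2 => f g) hPP
    simp only at h
    conv_lhs at h => rw [hdelta, map_add, map_smul, map_smul]
    rw [← apply_delta_apply hL]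
    exact h
  -- For `P = a + b u_z`, idempotency reads `a² + b² = a` and `2ab = b`. Non-triviality excludes `b
  -- = 0`, so `a = 1/2` and `b = ±1/2`.
  have e1 := hab 1
  have e2 := hab z
  rw [hz', ← ha, ← hb] at e1
  rw [hzz, ← ha, ← hb] at e2
  have hzero : b = 0 → a = 0 ∨ a = 1 := by
    intro hb0
    rw [hb0] at e1
    have : a * (a - 1) = 0 := by linear_combination e1
    rcases mul_eq_zero.1 this with h | h
    · exact Or.inl h
    · exact Or.inr (sub_eq_zero.1 h)
  have hb0 : b ≠ 0 := by
    intro hb0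
    rcases hzero hb0 with h | h
    · exact h0 (eq_zero_of_apply_delta_one hL (by rw [hdelta, h, hb0]; simp))
    · refine h1 (sub_eq_zero.1 (eq_zero_of_apply_delta_one (sub_mem hL (one_mem _)) ?_))
      rw [sub_apply, hdelta, h, hb0]
      simp
  have ha2 : a = 1 / 2 := by
    have : b * (2 * a - 1) = 0 := by linear_combination e2
    have := (mul_eq_zero.1 this).resolve_left hb0
    linear_combination this / 2
  have hb2 : (2 * b - 1) * (2 * b + 1) = 0 := by
    rw [ha2] at e1
    linear_combination 4 * e1
  rcases mul_eq_zero.1 hb2 with h | h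
  · refine ⟨1, ha2, ?_⟩
    rw [map_one]
    linear_combination h / 2
  · refine ⟨-1, ha2, ?_⟩
    rw [signCast_neg, map_one]
    linear_combination h / 2

end Projection

/-! ### Elements of `𝒞` as functions on the dual of `ℤ₂^∞`. -/

section Evaluation

variable {P : L2 Z2 →L[ℂ] L2 Z2} {ε : ℤˣ}

/-- The value is `(1 + ε x_n)/2`. From here on, this indicator formula is all that is used of the
projection. -/
theorem evalChar_copyAt (h1 : fourierCoeff P 1 = 1 / 2)
    (h2 : fourierCoeff P (Multiplicative.ofAdd 1) = signCast ε / 2) (x : ℕ → ℤˣ) (n : ℕ) :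
    evalChar x (copyAt P n) = if x n = ε then 1 else 0 := by
  have huniv : (Finset.univ : Finset Z2) = {1, Multiplicative.ofAdd 1} := by decide
  rw [copyAt, map_sum, huniv, Finset.sum_pair (by decide), evalChar_single, evalChar_single, h1,
    h2, pairing_coord, pairing_coord, toAdd_one, uzpow_zero, toAdd_ofAdd, uzpow_one]
  rcases Int.units_eq_one_or ε with rfl | rfl <;>
    rcases Int.units_eq_one_or (x n) with h | h <;> rw [h] <;> norm_num [signCast_apply]

theorem evalChar_copyAt_compl
    (hP : ∀ x n, evalChar x (copyAt P n) = if x n = ε then 1 else 0) (x : ℕ → ℤˣ) (n : ℕ) :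
    evalChar x (copyAt (1 - P) n) = if x n = -ε then 1 else 0 := by
  have h := congrArg (evalChar x) (copyAt_add_copyAt P n)
  rw [map_add, map_one, hP, ← eq_sub_iff_add_eq'] at h
  rw [h]
  rcases Int.units_eq_one_or ε with rfl | rfl <;>
    rcases Int.units_eq_one_or (x n) with h | h <;> rw [h] <;> norm_num

theorem evalChar_copyOn (hP : ∀ x n, evalChar x (copyAt P n) = if x n = ε then 1 else 0)
    (x : ℕ → ℤˣ) (K : Finset ℕ) :
    evalChar x (copyOn P K) = if ∀ n ∈ K, x n = ε then 1 else 0 := by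
  rw [copyOn, map_prod, Finset.prod_congr rfl fun n _ => hP x n, Finset.prod_ite_zero,
    Finset.prod_const_one]

theorem evalChar_block (hP : ∀ x n, evalChar x (copyAt P n) = if x n = ε then 1 else 0)
    (s : SInf) (x : ℕ → ℤˣ) (K : Finset ℕ) :
    evalChar x (block P s K) = (if ∀ n ∈ K, x n = ε then 1 else 0) +
      signCast (signOn s.1 K) * (if ∀ n ∈ K, x n = -ε then 1 else 0) := by
  rw [block, map_add, evalChar_copyOn hP, map_zsmul, evalChar_copyOn (evalChar_copyAt_compl hP),
    zsmul_eq_mul, signCast_apply]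

/-- Negating `x` exchanges the two indicators; since a sign squares to `1`, the exchange amounts to
multiplication by `sign(s|_K)`. -/
theorem evalChar_neg_block (hP : ∀ x n, evalChar x (copyAt P n) = if x n = ε then 1 else 0)
    (s : SInf) (x : ℕ → ℤˣ) (K : Finset ℕ) :
    evalChar (-x) (block P s K) = signCast (signOn s.1 K) * evalChar x (block P s K) := by
  rw [evalChar_block hP, evalChar_block hP, mul_add, ← mul_assoc, signCast_mul_self]
  simp only [Pi.neg_apply, neg_eq_iff_eq_neg, neg_neg]
  ring

theorem evalChar_neg_partProduct
    (hP : ∀ x n, evalChar x (copyAt P n) = if x n = ε then 1 else 0) (s : SInf) {𝒦 : Part}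
    (hs : Preserves s 𝒦) (x : ℕ → ℤˣ) : evalChar (-x) (partProduct P s 𝒦 hs) =
      signCast (sgn s) * evalChar x (partProduct P s 𝒦 hs) := by
  obtain ⟨F, -, hprod, hsgn, -⟩ := exists_finset_parts P s hs
  rw [hprod, ← hsgn, map_prod, map_prod, map_prod, ← Finset.prod_mul_distrib]
  exact Finset.prod_congr rfl fun K _ => evalChar_neg_block hP s x K

/-- The element of `𝒞` is supported on the characters that are fixed by `s`. -/
theorem comp_eq_of_evalChar_partProduct_ne_zero
    (hP : ∀ x n, evalChar x (copyAt P n) = if x n = ε then 1 else 0) (s : SInf) {𝒦 : Part}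
    (hs : Preserves s 𝒦) {x : ℕ → ℤˣ} (hx : evalChar x (partProduct P s 𝒦 hs) ≠ 0) :
    x ∘ s.1 = x := by
  obtain ⟨F, hpres, hprod, -, hfix⟩ := exists_finset_parts P s hs
  rw [hprod, map_prod, Finset.prod_ne_zero_iff] at hx
  funext n
  rcases hfix n with h | ⟨K, hK, hn⟩
  · rw [Function.comp_apply, h]
  · have h := hx K hK
    rw [evalChar_block hP] at h
    have hsn := (hpres K hK n).2 hn
    by_cases h1 : ∀ n ∈ K, x n = ε
    · rw [Function.comp_apply, h1 _ hn, h1 _ hsn]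
    · by_cases h2 : ∀ n ∈ K, x n = -ε
      · rw [Function.comp_apply, h2 _ hn, h2 _ hsn]
      · simp [h1, h2] at h

/-- Wherever the product does not vanish, `x` is fixed by `s` and so takes the same value at `s⁻¹ v`
and at `v`. -/
theorem single_permAction_mul_partProduct
    (hP : ∀ x n, evalChar x (copyAt P n) = if x n = ε then 1 else 0) (s : SInf) {𝒦 : Part}
    (hs : Preserves s 𝒦) (v : Z2Inf) :
    MonoidAlgebra.single (permAction s⁻¹ v) 1 * partProduct P s 𝒦 hs =
      MonoidAlgebra.single v 1 * partProduct P s 𝒦 hs := by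
  refine evalChar_separates fun x => ?_
  rw [map_mul, map_mul, evalChar_single, evalChar_single, pairing_permAction]
  by_cases hx : evalChar x (partProduct P s 𝒦 hs) = 0
  · rw [hx, mul_zero, mul_zero]
  · have h := comp_eq_of_evalChar_partProduct_ne_zero hP s hs hx
    have h' : x ∘ (s⁻¹).1 = x := by
      conv_lhs => rw [← h]
      funext n
      exact congrArg x (s.1.apply_symm_apply n)
    rw [h']

/-- The automorphism `v ↦ (-1)^{|v|} v` of the group algebra of `ℤ₂^∞`. -/
def flipHom : MonoidAlgebra ℂ Z2Inf →ₐ[ℂ] MonoidAlgebra ℂ Z2Inf :=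
  MonoidAlgebra.lift ℂ (MonoidAlgebra ℂ Z2Inf) Z2Inf
    { toFun := fun v => MonoidAlgebra.single v (signCast (pairing (-1) v))
      map_one' := by rw [map_one, map_one, MonoidAlgebra.one_def]
      map_mul' := fun v w => by rw [map_mul, map_mul, MonoidAlgebra.single_mul_single] }

theorem flipHom_single (v : Z2Inf) (c : ℂ) :
    flipHom (MonoidAlgebra.single v c) =
      MonoidAlgebra.single v (c * signCast (pairing (-1) v)) := by
  simp [flipHom, MonoidAlgebra.lift_single]

theorem evalChar_flipHom (x : ℕ → ℤˣ) (f : MonoidAlgebra ℂ Z2Inf) :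
    evalChar x (flipHom f) = evalChar (-x) f := by
  induction f using MonoidAlgebra.induction_linear with
  | zero => simp
  | add f g hf hg => rw [map_add, map_add, hf, hg, map_add]
  | single v c =>
    rw [flipHom_single, evalChar_single, evalChar_single, pairing_neg x, map_mul, mul_assoc]

theorem flipHom_partProduct (hP : ∀ x n, evalChar x (copyAt P n) = if x n = ε then 1 else 0)
    (s : SInf) {𝒦 : Part} (hs : Preserves s 𝒦) :
    flipHom (partProduct P s 𝒦 hs) = signCast (sgn s) • partProduct P s 𝒦 hs :=
  evalChar_separates fun x => by
    rw [evalChar_flipHom, evalChar_neg_partProduct hP, map_smul, smul_eq_mul]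

end Evaluation

/-! ### The algebra `L(G) ∩ L(ℤ₂^∞)' ∩ {parity}'` -/

section Algebra

theorem toOperator_single (v : Z2Inf) (c : ℂ) :
    toOperator (MonoidAlgebra.single v c) = c • leftReg WreathG (SemidirectProduct.inl v) := by
  simp [toOperator, MonoidAlgebra.lift_single]

theorem toOperator_mem (f : MonoidAlgebra ℂ Z2Inf) : toOperator f ∈ groupVN WreathG := by
  induction f using MonoidAlgebra.induction_linear with
  | zero => rw [map_zero]; exact zero_mem _
  | add f g hf hg => rw [map_add]; exact add_mem hf hg
  | single v c =>
    rw [toOperator_single]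
    exact (groupVN WreathG).toStarSubalgebra.smul_mem (leftReg_mem _) c

theorem parityOp_mul_toOperator (f : MonoidAlgebra ℂ Z2Inf) :
    parityOp * toOperator f = toOperator (flipHom f) * parityOp := by
  induction f using MonoidAlgebra.induction_linear with
  | zero => simp
  | add f g hf hg => rw [map_add, mul_add, hf, hg, map_add, map_add, add_mul]
  | single v c =>
    rw [flipHom_single, toOperator_single, toOperator_single, mul_smul_comm, parityOp_mul_leftReg,
      parity_inl, smul_smul, smul_mul_assoc]

theorem inl_mul_inr (v : Z2Inf) (s : SInf) :
    (SemidirectProduct.inl v * SemidirectProduct.inr s : WreathG) =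
      SemidirectProduct.inr s * SemidirectProduct.inl (permAction s⁻¹ v) := by
  ext1
  · simp only [SemidirectProduct.mul_left, SemidirectProduct.left_inl, SemidirectProduct.right_inl,
      SemidirectProduct.left_inr, SemidirectProduct.right_inr, map_one, mul_one, one_mul]
    rw [← MulAut.mul_apply, ← map_mul, mul_inv_cancel, map_one, MulAut.one_apply]
  · simp

/-- The algebra `L(G) ∩ L(ℤ₂^∞)' ∩ {parity}'`. -/
def wreathVN : VonNeumannAlgebra (L2 WreathG) :=
  relCommutant (Set.range (fun v : Z2Inf => leftReg WreathG (SemidirectProduct.inl v)) ∪ {parityOp})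

theorem mem_wreathVN_iff {x : L2 WreathG →L[ℂ] L2 WreathG} :
    x ∈ wreathVN ↔ x ∈ groupVN WreathG ∧
      (∀ v : Z2Inf, leftReg WreathG (SemidirectProduct.inl v) * x =
        x * leftReg WreathG (SemidirectProduct.inl v)) ∧ parityOp * x = x * parityOp := by
  rw [wreathVN, mem_relCommutant_iff]
  refine and_congr_right fun _ => ⟨fun h => ⟨fun v => (h _ (Or.inl ⟨v, rfl⟩)).1,
    (h _ (Or.inr rfl)).1⟩, ?_⟩
  rintro ⟨h1, h2⟩ _ (⟨v, rfl⟩ | rfl)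
  · refine ⟨h1 v, ?_⟩
    simp only [star_leftReg, ← map_inv]
    exact h1 v⁻¹
  · rw [star_parityOp]
    exact ⟨h2, h2⟩

/-- Moving `u_v` past `s` turns `v` into `s⁻¹ v`, which the product does not distinguish from `v`.
Moving `parityOp` across produces `sgn s` twice, once from `s` and once from the product. -/
theorem operatorsC_subset {P : L2 Z2 →L[ℂ] L2 Z2} {ε : ℤˣ}
    (hP : ∀ x n, evalChar x (copyAt P n) = if x n = ε then 1 else 0) :
    operatorsC P ⊆ (wreathVN : Set (L2 WreathG →L[ℂ] L2 WreathG)) := by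
  rintro _ ⟨s, 𝒦, hs, rfl⟩
  refine mem_wreathVN_iff.2 ⟨mul_mem (leftReg_mem _) (toOperator_mem _), fun v => ?_, ?_⟩
  · have h : ∀ w, leftReg WreathG (SemidirectProduct.inl w) =
        toOperator (MonoidAlgebra.single w 1) := fun w => by rw [toOperator_single, one_smul]
    rw [← mul_assoc, ← map_mul, inl_mul_inr, map_mul, mul_assoc, mul_assoc, h, h, ← map_mul,
      ← map_mul, single_permAction_mul_partProduct hP, mul_comm]
  · rw [← mul_assoc, parityOp_mul_leftReg, parity_inr, smul_mul_assoc, mul_assoc,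
      parityOp_mul_toOperator, flipHom_partProduct hP, map_smul, smul_mul_assoc, mul_smul_comm,
      smul_smul, signCast_mul_self, one_smul, mul_assoc]

theorem mPart_subset {P : L2 Z2 →L[ℂ] L2 Z2} {ε : ℤˣ}
    (hP : ∀ x n, evalChar x (copyAt P n) = if x n = ε then 1 else 0) :
    mPart P ⊆ (wreathVN : Set (L2 WreathG →L[ℂ] L2 WreathG)) := by
  let := weakStarTopology (L2 WreathG)
  refine closure_minimal ?_ (isClosed_relCommutant _)
  exact Submodule.span_le (p := Subalgebra.toSubmodule wreathVN.toStarSubalgebra.toSubalgebra).2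
    (operatorsC_subset hP)

end Algebra

/-! ### Elements of the span of `𝒞` -/

section Span

/-- The partition of `ℕ` into the members of a disjoint family and one-point sets. -/
def Part.ofFamily (F : Finset (Finset ℕ)) (h0 : ∅ ∉ F)
    (hd : (F : Set (Finset ℕ)).PairwiseDisjoint id) : Part where
  parts := {K | K ∈ F ∨ ∃ n, (∀ L ∈ F, n ∉ L) ∧ K = {n}}
  empty_notMem := by
    rintro (h | ⟨n, -, h⟩)
    · exact h0 h
    · exact Finset.singleton_ne_empty n h.symm
  cover n := by
    by_cases h : ∃ L ∈ F, n ∈ L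
    · obtain ⟨L, hL, hn⟩ := h
      refine ⟨L, ⟨Or.inl hL, hn⟩, ?_⟩
      rintro K ⟨hK | ⟨m, hm, rfl⟩, hnK⟩
      · by_contra hne
        exact Finset.disjoint_left.1 (hd hK hL hne) hnK hn
      · rw [Finset.mem_singleton] at hnK
        exact absurd hn (hnK ▸ hm L hL)
    · push Not at h
      refine ⟨{n}, ⟨Or.inr ⟨n, h, rfl⟩, Finset.mem_singleton_self n⟩, ?_⟩
      rintro K ⟨hK | ⟨m, hm, rfl⟩, hnK⟩
      · exact absurd hnK (h K hK)
      · rw [Finset.mem_singleton.1 hnK]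
  finite := F.finite_toSet.subset (by
    rintro K ⟨hK | ⟨m, -, rfl⟩, hc⟩
    · exact hK
    · simp at hc)

theorem mul_prod_block_mem_operatorsC (P : L2 Z2 →L[ℂ] L2 Z2) {s : SInf} {F : Finset (Finset ℕ)}
    (h0 : ∅ ∉ F) (hd : (F : Set (Finset ℕ)).PairwiseDisjoint id)
    (hpres : ∀ K ∈ F, ∀ n, s.1 n ∈ K ↔ n ∈ K) (hfix : ∀ n, (∀ K ∈ F, n ∉ K) → s.1 n = n) :
    leftReg WreathG (SemidirectProduct.inr s) * toOperator (∏ K ∈ F, block P s K) ∈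
      operatorsC P := by
  have hs : Preserves s (Part.ofFamily F h0 hd) := by
    rintro K (hK | ⟨n, hn, rfl⟩) m
    · exact hpres K hK m
    · have h := hfix n hn
      rw [Finset.mem_singleton, Finset.mem_singleton]
      exact ⟨fun hm => s.1.injective (hm.trans h.symm), fun hm => by rw [hm, h]⟩
  refine ⟨s, Part.ofFamily F h0 hd, hs, ?_⟩
  rw [partProduct_eq_prod P s hs (F := F) (fun K hK => Or.inl hK)]
  rintro K (hK | ⟨n, -, rfl⟩) hc
  · exact hK
  · simp at hc

/-- The minimal projection `P^{R \ K} (1 - P)^K`. -/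
def atom (P : L2 Z2 →L[ℂ] L2 Z2) (R K : Finset ℕ) : MonoidAlgebra ℂ Z2Inf :=
  copyOn P (R \ K) * copyOn (1 - P) K

theorem atom_add_mem_span (P : L2 Z2 →L[ℂ] L2 Z2) {s : SInf} {R K : Finset ℕ} (hR : R.Nonempty)
    (hK : K ⊆ R) (hfix : ∀ n ∉ R, s.1 n = n) (hpres : ∀ n, s.1 n ∈ K ↔ n ∈ K) :
    leftReg WreathG (SemidirectProduct.inr s) *
        toOperator (atom P R K + (sgn s : ℤ) • atom P R (R \ K)) ∈
      Submodule.span ℂ (operatorsC P) := by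
  have hpR := preserves_of_fixed_compl hfix
  have hpC : ∀ n, s.1 n ∈ R \ K ↔ n ∈ R \ K := fun n => by simp [hpR, hpres]
  have hsgn : (sgn s : ℤ) = signOn s.1 R := by rw [sgn_eq_signOn hfix]
  have hmem : leftReg WreathG (SemidirectProduct.inr s) * toOperator (block P s R) ∈
      Submodule.span ℂ (operatorsC P) := by
    refine Submodule.subset_span ?_
    have h := mul_prod_block_mem_operatorsC P (s := s) (F := {R})
      (by simpa using hR.ne_empty.symm) (by simp) (by simpa using hpR) (by simpa using hfix)
    rwa [Finset.prod_singleton] at h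
  have hzsmul : ∀ (u : ℤˣ) (f : MonoidAlgebra ℂ Z2Inf),
      leftReg WreathG (SemidirectProduct.inr s) * toOperator f ∈ Submodule.span ℂ (operatorsC P) →
      leftReg WreathG (SemidirectProduct.inr s) * toOperator ((u : ℤ) • f) ∈
        Submodule.span ℂ (operatorsC P) := by
    intro u f hf
    rw [map_zsmul, mul_smul_comm]
    exact zsmul_mem hf _
  have hss : ∀ u : ℤˣ, (u : ℤ) * u = 1 := fun u => by
    rw [← Units.val_mul, Int.units_mul_self, Units.val_one]
  -- If `K` or `R \ K` is empty, the sum is, up to a sign, the single block on `R`; the empty set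
  -- cannot be a part, so these cases are separate.
  rcases K.eq_empty_or_nonempty with rfl | hne
  · convert! hmem using 3
    simp [atom, block, copyOn, hsgn]
  rcases (R \ K).eq_empty_or_nonempty with hemp | hne'
  · obtain rfl : K = R := hK.antisymm (Finset.sdiff_eq_empty_iff_subset.1 hemp)
    convert! hzsmul (signOn s.1 K) _ hmem using 3
    rw [block, smul_add, smul_smul, hss, one_smul, add_comm, atom, atom, hemp, Finset.sdiff_empty,
      hsgn]
    simp [copyOn]
  · have hne2 : R \ K ≠ K := fun h => hne'.ne_empty (by
      have hd : Disjoint (R \ K) K := Finset.sdiff_disjoint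
      rw [h, disjoint_self, Finset.bot_eq_empty] at hd
      rw [h, hd])
    have hmem2 := Submodule.subset_span (R := ℂ) (mul_prod_block_mem_operatorsC P (s := s)
      (F := {R \ K, K}) (by simp [hne.ne_empty.symm, hne'.ne_empty.symm])
      (by
        rw [Finset.coe_pair]
        exact Set.pairwise_pair.2 fun _ => ⟨Finset.sdiff_disjoint, Finset.disjoint_sdiff⟩)
      (by simpa using ⟨fun n => by simpa using hpC n, hpres⟩)
      (by
        intro n hn
        refine hfix n fun h => ?_
        by_cases hnK : n ∈ K
        · exact hn K (by simp) hnK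
        · exact hn (R \ K) (by simp) (Finset.mem_sdiff.2 ⟨h, hnK⟩)))
    rw [Finset.prod_pair hne2] at hmem2
    -- Write `p`, `q` for the two projections, `A = R \ K`, and `a`, `k` for the signs of `s` on
    -- `A`, `K`. Then `(p^A + a q^A)(p^K + k q^K) - (p^R + ak q^R) = k p^A q^K + a q^A p^K`, and
    -- multiplication by `k` gives the required sum.
    have hsub := hzsmul (signOn s.1 K) (block P s (R \ K) * block P s K - block P s R) (by
      rw [map_sub, mul_sub]
      exact sub_mem hmem2 hmem)
    convert! hsub using 3
    have hsplit : ∀ Q : L2 Z2 →L[ℂ] L2 Z2, copyOn Q R = copyOn Q (R \ K) * copyOn Q K := fun Q =>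
      (Finset.prod_sdiff hK).symm
    have hsR : (signOn s.1 R : ℤ) = signOn s.1 (R \ K) * signOn s.1 K := by
      rw [← Units.val_mul, ← signOn_union Finset.sdiff_disjoint hpC hpres,
        Finset.sdiff_union_of_subset hK]
    rw [hsgn, hsR, block, block, block, hsplit P, hsplit (1 - P), hsR, atom, atom,
      Finset.sdiff_sdiff_eq_self hK]
    simp only [zsmul_eq_mul, Int.cast_mul]
    have hss' : ((signOn s.1 K : ℤ) : MonoidAlgebra ℂ Z2Inf) * (signOn s.1 K : ℤ) = 1 := by
      rw [← Int.cast_mul, hss, Int.cast_one]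
    linear_combination (-(copyOn P (R \ K) * copyOn (1 - P) K)) * hss'

variable {P : L2 Z2 →L[ℂ] L2 Z2} {ε : ℤˣ}

theorem units_eq_or_eq_neg (u v : ℤˣ) : u = v ∨ u = -v := by
  rcases Int.units_eq_one_or u with rfl | rfl <;> rcases Int.units_eq_one_or v with rfl | rfl <;>
    decide

theorem evalChar_atom (hP : ∀ x n, evalChar x (copyAt P n) = if x n = ε then 1 else 0)
    (y : ℕ → ℤˣ) {R K : Finset ℕ} (hK : K ⊆ R) :
    evalChar y (atom P R K) = if K = R.filter (fun n => y n = -ε) then 1 else 0 := by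
  have hε : ε ≠ -ε := by
    rcases Int.units_eq_one_or ε with rfl | rfl <;> decide
  rw [atom, map_mul, evalChar_copyOn hP, evalChar_copyOn (evalChar_copyAt_compl hP),
    ite_zero_mul_ite_zero, mul_one]
  refine if_congr ⟨?_, ?_⟩ rfl rfl
  · rintro ⟨h1, h2⟩
    ext n
    rw [Finset.mem_filter]
    refine ⟨fun hn => ⟨hK hn, h2 n hn⟩, fun ⟨hn, hy⟩ => ?_⟩
    by_contra hc
    exact hε ((h1 n (Finset.mem_sdiff.2 ⟨hn, hc⟩)).symm.trans hy)
  · intro h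
    refine ⟨fun n hn => ?_, fun n hn => ?_⟩
    · rw [Finset.mem_sdiff, h, Finset.mem_filter, not_and] at hn
      have h' := hn.2 hn.1
      rcases units_eq_or_eq_neg (y n) ε with h2 | h2
      · exact h2
      · exact absurd h2 h'
    · rw [h, Finset.mem_filter] at hn
      exact hn.2

/-- The character that takes the value `-ε` on `K` and `ε` elsewhere. -/
def signChar (ε : ℤˣ) (K : Finset ℕ) (n : ℕ) : ℤˣ := if n ∈ K then -ε else ε

/-- By `hloc`, `f` is a function on the finite cube `{±1}^R`, a combination of atoms indexed by
subsets `K`. By `hneg`, the coefficients at `K` and `R \ K` differ by the factor `sgn s`, so the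
atoms group in pairs; by `hsupp`, only `s`-invariant `K` occur. -/
theorem mul_toOperator_mem_span
    (hP : ∀ x n, evalChar x (copyAt P n) = if x n = ε then 1 else 0) {s : SInf} {R : Finset ℕ}
    (hR : R.Nonempty) (hfix : ∀ n ∉ R, s.1 n = n) {f : MonoidAlgebra ℂ Z2Inf}
    (hloc : ∀ x y : ℕ → ℤˣ, (∀ n ∈ R, x n = y n) → evalChar x f = evalChar y f)
    (hneg : ∀ x, evalChar (-x) f = signCast (sgn s) * evalChar x f)
    (hsupp : ∀ x, evalChar x f ≠ 0 → x ∘ s.1 = x) :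
    leftReg WreathG (SemidirectProduct.inr s) * toOperator f ∈
      Submodule.span ℂ (operatorsC P) := by
  have hε : ε ≠ -ε := by
    rcases Int.units_eq_one_or ε with rfl | rfl <;> decide
  -- The sum over all subsets meets each pair `{K, R \ K}` twice, whence the division by `2`.
  have hf : f = ∑ K ∈ R.powerset, (evalChar (signChar ε K) f / 2) •
      (atom P R K + (sgn s : ℤ) • atom P R (R \ K)) := by
    refine evalChar_separates fun y => ?_
    set Y := R.filter (fun n => y n = -ε) with hY
    have hYR : Y ⊆ R := Finset.filter_subset _ _
    have h1 : ∀ K ∈ R.powerset, evalChar y ((evalChar (signChar ε K) f / 2) •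
        (atom P R K + (sgn s : ℤ) • atom P R (R \ K))) =
        (if K = Y then evalChar (signChar ε K) f / 2 else 0) +
        (if K = R \ Y then signCast (sgn s) * evalChar (signChar ε K) f / 2 else 0) := by
      intro K hK
      rw [Finset.mem_powerset] at hK
      have hiff : R \ K = Y ↔ K = R \ Y :=
        ⟨fun h => by rw [← h, Finset.sdiff_sdiff_eq_self hK],
          fun h => by rw [h, Finset.sdiff_sdiff_eq_self hYR]⟩
      rw [map_smul, map_add, map_zsmul, evalChar_atom hP y hK,
        evalChar_atom hP y Finset.sdiff_subset, ← hY, if_congr hiff rfl rfl, zsmul_eq_mul,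
        ← signCast_apply, smul_eq_mul]
      split_ifs <;> ring
    rw [map_sum, Finset.sum_congr rfl h1, Finset.sum_add_distrib, Finset.sum_ite_eq',
      Finset.sum_ite_eq', if_pos (Finset.mem_powerset.2 hYR),
      if_pos (Finset.mem_powerset.2 Finset.sdiff_subset)]
    have h2 : evalChar (signChar ε Y) f = evalChar y f := by
      refine hloc _ _ fun n hn => ?_
      rw [signChar]
      split_ifs with h
      · exact (Finset.mem_filter.1 h).2.symm
      · exact ((units_eq_or_eq_neg (y n) ε).resolve_right fun h' =>
          h (Finset.mem_filter.2 ⟨hn, h'⟩)).symm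
    have h3 : evalChar (signChar ε (R \ Y)) f = evalChar (-y) f := by
      refine hloc _ _ fun n hn => ?_
      rw [signChar, Pi.neg_apply]
      split_ifs with h
      · rw [(units_eq_or_eq_neg (y n) ε).resolve_right fun h' =>
          (Finset.mem_sdiff.1 h).2 (Finset.mem_filter.2 ⟨hn, h'⟩)]
      · have h' : n ∈ Y := by
          by_contra hc
          exact h (Finset.mem_sdiff.2 ⟨hn, hc⟩)
        rw [(Finset.mem_filter.1 h').2, neg_neg]
    rw [h2, h3, hneg, ← mul_assoc, signCast_mul_self]
    ring
  rw [hf, map_sum, Finset.mul_sum]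
  refine Submodule.sum_mem _ fun K hK => ?_
  rw [map_smul, mul_smul_comm]
  by_cases h0 : evalChar (signChar ε K) f = 0
  · rw [h0, zero_div, zero_smul]
    exact zero_mem _
  · refine Submodule.smul_mem _ _ (atom_add_mem_span P hR (Finset.mem_powerset.1 hK) hfix fun n => ?_)
    have h := congrFun (hsupp _ h0) n
    simp only [Function.comp_apply, signChar] at h
    split_ifs at h with h1 h2 h2
    · exact iff_of_true h1 h2
    · exact absurd h.symm hε
    · exact absurd h hε
    · exact iff_of_false h1 h2

end Span

/-! ### Truncation to finite subgroups -/

section Truncation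

/-- The permutations that fix every `m ≥ n`. -/
def permLevel (n : ℕ) : Subgroup SInf where
  carrier := {s | ∀ m, n ≤ m → s.1 m = m}
  one_mem' _ _ := rfl
  mul_mem' {s t} hs ht m hm := by
    change s.1 (t.1 m) = m
    rw [ht m hm, hs m hm]
  inv_mem' {s} hs m hm := Equiv.Perm.inv_eq_iff_eq.2 (hs m hm).symm

/-- The elements of `ℤ₂^∞` that are supported on the coordinates below `n`. -/
def vecLevel (n : ℕ) : Subgroup Z2Inf where
  carrier := {v | ∀ m, n ≤ m → v.toAdd m = 0}
  one_mem' _ _ := rfl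
  mul_mem' {v w} hv hw m hm := by
    change v.toAdd m + w.toAdd m = 0
    rw [hv m hm, hw m hm, add_zero]
  inv_mem' {v} hv m hm := by
    change -v.toAdd m = 0
    rw [hv m hm, neg_zero]

theorem permAction_mem_vecLevel {n : ℕ} {s : SInf} (hs : s ∈ permLevel n) {v : Z2Inf}
    (hv : v ∈ vecLevel n) : permAction s v ∈ vecLevel n := fun m hm => by
  change v.toAdd (s.1.symm m) = 0
  have h : s.1.symm m = m := s.1.symm_apply_eq.2 (hs m hm).symm
  rw [h, hv m hm]

theorem permAction_mem_vecLevel_iff {n : ℕ} {s : SInf} (hs : s ∈ permLevel n) {v : Z2Inf} :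
    permAction s v ∈ vecLevel n ↔ v ∈ vecLevel n := by
  refine ⟨fun h => ?_, permAction_mem_vecLevel hs⟩
  have h' := permAction_mem_vecLevel (inv_mem hs) h
  rwa [← MulAut.mul_apply, ← map_mul, inv_mul_cancel, map_one, MulAut.one_apply] at h'

theorem coord_mem_vecLevel {n m : ℕ} (hm : m < n) (z : Z2) : coord m z ∈ vecLevel n :=
  fun k hk => Finsupp.single_eq_of_ne (by omega)

theorem finite_permLevel (n : ℕ) : (permLevel n : Set SInf).Finite := by
  have hlt : ∀ s ∈ permLevel n, ∀ i < n, s.1 i < n := fun s hs i hi => by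
    by_contra hc
    have := s.1.injective (hs _ (not_lt.1 hc))
    omega
  refine Set.Finite.of_finite_image (f := fun s : SInf => fun i : Fin n => s.1 i)
    ((Set.Finite.pi' fun _ => Set.finite_Iio n).subset ?_) ?_
  · rintro _ ⟨s, hs, rfl⟩ i
    exact hlt s hs i i.2
  · intro s hs t ht hst
    refine Subtype.ext (Equiv.ext fun m => ?_)
    rcases lt_or_ge m n with hm | hm
    · exact congrFun hst ⟨m, hm⟩
    · rw [hs m hm, ht m hm]

theorem finite_vecLevel (n : ℕ) : (vecLevel n : Set Z2Inf).Finite := by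
  refine Set.Finite.of_finite_image (f := fun v : Z2Inf => fun i : Fin n => v.toAdd i)
    (Set.toFinite _) ?_
  intro v hv w hw hvw
  refine Multiplicative.toAdd.injective (Finsupp.ext fun m => ?_)
  rcases lt_or_ge m n with hm | hm
  · exact congrFun hvw ⟨m, hm⟩
  · rw [hv m hm, hw m hm]

theorem eventually_mem_permLevel (s : SInf) : ∀ᶠ n in atTop, s ∈ permLevel n := by
  obtain ⟨N, hN⟩ := (finite_support s).bddAbove
  filter_upwards [eventually_gt_atTop N] with n hn m hm
  by_contra hc
  have := hN hc
  omega

theorem eventually_mem_vecLevel (v : Z2Inf) : ∀ᶠ n in atTop, v ∈ vecLevel n := by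
  obtain ⟨N, hN⟩ := v.toAdd.hasFiniteSupport.bddAbove
  filter_upwards [eventually_gt_atTop N] with n hn m hm
  by_contra hc
  have := hN hc
  omega

/-- The finite subgroup of `G` of the elements at level `n`. -/
def level (n : ℕ) : Subgroup WreathG where
  carrier := {g | g.right ∈ permLevel n ∧ g.left ∈ vecLevel n}
  one_mem' := ⟨one_mem _, one_mem _⟩
  mul_mem' hg hh := ⟨mul_mem hg.1 hh.1, mul_mem hg.2 (permAction_mem_vecLevel hg.1 hh.2)⟩
  inv_mem' hg := ⟨inv_mem hg.1, permAction_mem_vecLevel (inv_mem hg.1) (inv_mem hg.2)⟩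

theorem mem_level {n : ℕ} {g : WreathG} :
    g ∈ level n ↔ g.right ∈ permLevel n ∧ g.left ∈ vecLevel n := Iff.rfl

theorem eventually_mem_level (g : WreathG) : ∀ᶠ n in atTop, g ∈ level n :=
  (eventually_mem_permLevel g.right).and (eventually_mem_vecLevel g.left)

/-- The part at `s` of the truncation of `x` to the `n`-th level. -/
def truncPart (x : L2 WreathG →L[ℂ] L2 WreathG) (n : ℕ) (s : SInf) : MonoidAlgebra ℂ Z2Inf :=
  ∑ v ∈ (finite_vecLevel n).toFinset, MonoidAlgebra.single v
    (fourierCoeff x (SemidirectProduct.inr s * SemidirectProduct.inl v))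

/-- The truncation of the Fourier series of `x` to the `n`-th level. -/
def trunc (x : L2 WreathG →L[ℂ] L2 WreathG) (n : ℕ) : L2 WreathG →L[ℂ] L2 WreathG :=
  ∑ s ∈ (finite_permLevel n).toFinset,
    leftReg WreathG (SemidirectProduct.inr s) * toOperator (truncPart x n s)

theorem evalChar_truncPart (x : L2 WreathG →L[ℂ] L2 WreathG) (n : ℕ) (s : SInf) (y : ℕ → ℤˣ) :
    evalChar y (truncPart x n s) = ∑ v ∈ (finite_vecLevel n).toFinset,
      fourierCoeff x (SemidirectProduct.inr s * SemidirectProduct.inl v) *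
        signCast (pairing y v) := by
  rw [truncPart, map_sum]
  exact Finset.sum_congr rfl fun v _ => evalChar_single _ _ _

theorem eq_inr_mul_inl_iff {g : WreathG} {s : SInf} {v : Z2Inf} :
    g = SemidirectProduct.inr s * SemidirectProduct.inl v ↔
      s = g.right ∧ v = permAction g.right⁻¹ g.left := by
  constructor
  · rintro rfl
    simp only [SemidirectProduct.mul_left, SemidirectProduct.mul_right, SemidirectProduct.left_inl,
      SemidirectProduct.right_inl, SemidirectProduct.left_inr, SemidirectProduct.right_inr, mul_one,
      one_mul, true_and]
    rw [← MulAut.mul_apply, ← map_mul, inv_mul_cancel, map_one, MulAut.one_apply]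
  · rintro ⟨rfl, rfl⟩
    ext1
    · simp only [SemidirectProduct.mul_left, SemidirectProduct.left_inl, SemidirectProduct.left_inr,
        SemidirectProduct.right_inr, one_mul]
      rw [← MulAut.mul_apply, ← map_mul, mul_inv_cancel, map_one, MulAut.one_apply]
    · simp

open scoped Classical in
theorem trunc_delta_apply (x : L2 WreathG →L[ℂ] L2 WreathG) (n : ℕ) (g h : WreathG) :
    trunc x n (delta h) g = if g * h⁻¹ ∈ level n then fourierCoeff x (g * h⁻¹) else 0 := by
  set k := g * h⁻¹ with hk
  have h1 : trunc x n (delta h) g = ∑ s ∈ (finite_permLevel n).toFinset,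
      ∑ v ∈ (finite_vecLevel n).toFinset,
        if s = k.right then (if v = permAction k.right⁻¹ k.left then fourierCoeff x k else 0)
        else 0 := by
    rw [← inner_delta_left, trunc, sum_apply, inner_sum]
    refine Finset.sum_congr rfl fun s _ => ?_
    rw [truncPart, map_sum, Finset.mul_sum, sum_apply, inner_sum]
    refine Finset.sum_congr rfl fun v _ => ?_
    rw [toOperator_single, mul_smul_comm, ← map_mul, smul_apply, inner_smul_right, leftReg_delta,
      inner_delta_left, delta_apply, ← ite_and]
    have hiff : g = SemidirectProduct.inr s * SemidirectProduct.inl v * h ↔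
        s = k.right ∧ v = permAction k.right⁻¹ k.left := by
      rw [← eq_inr_mul_inl_iff, hk, mul_inv_eq_iff_eq_mul]
    rw [if_congr hiff rfl rfl]
    split_ifs with hc
    · rw [mul_one, ← eq_inr_mul_inl_iff.2 hc]
    · rw [mul_zero]
  have h2 : permAction k.right⁻¹ k.left ∈ (finite_vecLevel n).toFinset ↔
      permAction k.right⁻¹ k.left ∈ vecLevel n := by
    rw [Set.Finite.mem_toFinset, SetLike.mem_coe]
  simp only [h1, Finset.sum_ite_irrel, Finset.sum_const_zero, Finset.sum_ite_eq', mem_level]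
  have h3 : k.right ∈ (finite_permLevel n).toFinset ↔ k.right ∈ permLevel n := by
    rw [Set.Finite.mem_toFinset, SetLike.mem_coe]
  rw [ite_and]
  by_cases hkr : k.right ∈ permLevel n
  · rw [if_pos (h3.2 hkr), if_pos hkr]
    exact if_congr (h2.trans (permAction_mem_vecLevel_iff (inv_mem hkr))) rfl rfl
  · rw [if_neg fun h => hkr (h3.1 h), if_neg hkr]

theorem norm_trunc_le {x : L2 WreathG →L[ℂ] L2 WreathG} (hx : x ∈ groupVN WreathG) (n : ℕ) :
    ‖trunc x n‖ ≤ ‖x‖ := by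
  classical
  -- The fibres of `g ↦ g⁻¹ · level n` are the right cosets of `level n`. Keeping the matrix entries
  -- with `g h⁻¹ ∈ level n` is the compression of `x` to these blocks.
  refine norm_le_of_blockDiagonal (fun g : WreathG => ((g⁻¹ : WreathG) : WreathG ⧸ level n)) _ _
    fun f g => ?_
  set A : Set WreathG := (fun g : WreathG => ((g⁻¹ : WreathG) : WreathG ⧸ level n)) ⁻¹'
    {((g⁻¹ : WreathG) : WreathG ⧸ level n)} with hA
  have h : (innerSL ℂ (delta g)).comp (trunc x n) =
      (innerSL ℂ (delta g)).comp (x * indicatorOp A) := by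
    refine ext_delta fun h => ?_
    have hiff : h ∈ A ↔ g * h⁻¹ ∈ level n := by
      rw [hA, Set.mem_preimage, Set.mem_singleton_iff, eq_comm, QuotientGroup.eq, inv_inv]
    rw [ContinuousLinearMap.comp_apply, ContinuousLinearMap.comp_apply, innerSL_apply_apply,
      innerSL_apply_apply, inner_delta_left, inner_delta_left, trunc_delta_apply,
      mul_apply_eq_comp, indicatorOp, mulOp_delta, map_smul]
    change _ = A.indicator 1 h * x (delta h) g
    rw [apply_delta_apply hx, Set.indicator_apply, if_congr hiff rfl rfl]
    split_ifs <;> simp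
  have h' := DFunLike.congr_fun h f
  rwa [ContinuousLinearMap.comp_apply, ContinuousLinearMap.comp_apply, innerSL_apply_apply,
    innerSL_apply_apply, inner_delta_left, inner_delta_left] at h'

/-- Each matrix coefficient of the truncations is eventually equal to that of `x`, and the norms are
bounded by `‖x‖`. -/
theorem tendsto_trunc {x : L2 WreathG →L[ℂ] L2 WreathG} (hx : x ∈ groupVN WreathG) :
    Tendsto (trunc x) atTop (@nhds _ (weakStarTopology (L2 WreathG)) x) := by
  classical
  refine tendsto_weakStar_of_bounded (norm_trunc_le hx)
    (tendsto_inner_of_dense dense_span_delta (norm_trunc_le hx) ?_)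
  rintro _ ⟨g, rfl⟩ _ ⟨h, rfl⟩
  refine tendsto_const_nhds.congr' ?_
  filter_upwards [eventually_mem_level (g * h⁻¹)] with n hn
  rw [inner_delta_left, inner_delta_left, trunc_delta_apply, if_pos hn, apply_delta_apply hx]

theorem fourierCoeff_conj {x : L2 WreathG →L[ℂ] L2 WreathG} (hx : x ∈ wreathVN) (w : Z2Inf)
    (g : WreathG) : fourierCoeff x (SemidirectProduct.inl w * g * (SemidirectProduct.inl w)⁻¹) =
      fourierCoeff x g := by
  obtain ⟨hxG, hw, -⟩ := mem_wreathVN_iff.1 hx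
  have h := congrArg (fun T : L2 WreathG →L[ℂ] L2 WreathG =>
    T (delta 1) (SemidirectProduct.inl w * g)) (hw w)
  simp only [mul_apply_eq_comp] at h
  rw [leftReg_apply, leftReg_delta, mul_one, apply_delta_apply hxG (SemidirectProduct.inl w),
    inv_mul_cancel_left] at h
  exact h.symm

theorem parity_eq_one_of_fourierCoeff_ne_zero {x : L2 WreathG →L[ℂ] L2 WreathG}
    (hx : x ∈ wreathVN) {g : WreathG} (hg : fourierCoeff x g ≠ 0) : parity g = 1 := by
  obtain ⟨-, -, hp⟩ := mem_wreathVN_iff.1 hx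
  have h := congrArg (fun T : L2 WreathG →L[ℂ] L2 WreathG => T (delta 1) g) hp
  simp only [mul_apply_eq_comp] at h
  have h1 : parityOp (delta 1) = delta 1 := by
    rw [parityOp, mulOp_delta, map_one, map_one, one_smul]
  rw [parityOp_apply, h1] at h
  refine signCast_injective ?_
  rw [map_one]
  exact mul_right_cancel₀ hg (h.trans (one_mul _).symm)

theorem trunc_mem_span {P : L2 Z2 →L[ℂ] L2 Z2} {ε : ℤˣ}
    (hP : ∀ x n, evalChar x (copyAt P n) = if x n = ε then 1 else 0)
    {x : L2 WreathG →L[ℂ] L2 WreathG} (hx : x ∈ wreathVN) (n : ℕ) :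
    trunc x n ∈ Submodule.span ℂ (operatorsC P) := by
  refine Submodule.sum_mem _ fun s hs => ?_
  rw [Set.Finite.mem_toFinset, SetLike.mem_coe] at hs
  have hv : ∀ v ∈ (finite_vecLevel n).toFinset, v ∈ vecLevel n := fun v hv => by
    rwa [Set.Finite.mem_toFinset, SetLike.mem_coe] at hv
  -- The range up to `n + 1` rather than `n` keeps the set non-empty when `n = 0`.
  refine mul_toOperator_mem_span hP (R := Finset.range (n + 1)) ⟨0, by simp⟩ ?_ ?_ ?_ ?_
  · exact fun m hm => hs m (by rw [Finset.mem_range] at hm; omega)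
  · intro y y' hyy'
    rw [evalChar_truncPart, evalChar_truncPart]
    refine Finset.sum_congr rfl fun v hv' => ?_
    rw [pairing_congr fun m hm => hyy' m ?_]
    by_contra hc
    exact hm (hv v hv' m (by rw [Finset.mem_range] at hc; omega))
  · intro y
    rw [evalChar_truncPart, evalChar_truncPart, Finset.mul_sum]
    refine Finset.sum_congr rfl fun v _ => ?_
    by_cases h0 : fourierCoeff x (SemidirectProduct.inr s * SemidirectProduct.inl v) = 0
    · rw [h0]
      ring
    · have h := parity_eq_one_of_fourierCoeff_ne_zero hx h0
      rw [map_mul, parity_inr, parity_inl] at h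
      have h' : pairing (-1) v = sgn s := by
        rw [← one_mul (pairing (-1) v), ← Int.units_mul_self (sgn s), mul_assoc, h, mul_one]
      rw [pairing_neg y, map_mul, h']
      ring
  · intro y hy
    have hinv : ∀ w ∈ vecLevel n, pairing (y ∘ (s⁻¹).1) w = pairing y w := by
      intro w hw
      -- Conjugating `s v` by `w` gives `s (v u)`, so the Fourier coefficients at `s` are invariant
      -- under the shift by `u`. The value at `y` is thus multiplied by `y(u)`, and as it is
      -- non-zero, `y(u) = 1`, that is, `y(s⁻¹ w) = y(w)`.
      set u := permAction s⁻¹ w * w⁻¹ with hu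
      have huL : u ∈ vecLevel n :=
        mul_mem (permAction_mem_vecLevel (inv_mem hs) hw) (inv_mem hw)
      have h1 : evalChar y (truncPart x n s) =
          signCast (pairing y u) * evalChar y (truncPart x n s) := by
        conv_lhs => rw [evalChar_truncPart]
        rw [evalChar_truncPart, Finset.mul_sum]
        refine (Finset.sum_equiv (Equiv.mulRight u) (fun v => ?_) fun v _ => ?_).symm
        · rw [Set.Finite.mem_toFinset, Set.Finite.mem_toFinset, SetLike.mem_coe, SetLike.mem_coe,
            Equiv.coe_mulRight, Subgroup.mul_mem_cancel_right _ huL]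
        · have h2 : (SemidirectProduct.inr s * SemidirectProduct.inl (v * u) : WreathG) =
              SemidirectProduct.inl w * (SemidirectProduct.inr s * SemidirectProduct.inl v) *
                (SemidirectProduct.inl w)⁻¹ := by
            rw [← mul_assoc (SemidirectProduct.inl w), inl_mul_inr, ← map_inv, mul_assoc, mul_assoc,
              ← map_mul, ← map_mul, hu]
            congr 2
            exact mul_left_comm _ _ _
          rw [Equiv.coe_mulRight, h2, fourierCoeff_conj hx, map_mul (pairing y) v u, map_mul signCast]
          ring
      have h3 : signCast (pairing y u) = 1 := mul_right_cancel₀ hy (h1.symm.trans (one_mul _).symm)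
      have h4 : pairing y u = 1 := signCast_injective (h3.trans (map_one _).symm)
      rwa [hu, map_mul, map_inv (pairing y), mul_inv_eq_one, pairing_permAction] at h4
    -- Below `n` the invariance is tested on the coordinate generators; from `n` on, `s` fixes every
    -- point.
    have hs' : ∀ m, y ((s⁻¹).1 m) = y m := by
      intro m
      rcases lt_or_ge m n with hm | hm
      · have h := hinv _ (coord_mem_vecLevel hm (Multiplicative.ofAdd 1))
        rwa [pairing_coord, pairing_coord, toAdd_ofAdd, uzpow_one, uzpow_one] at h
      · rw [inv_mem hs m hm]
    funext m
    rw [Function.comp_apply, ← hs' (s.1 m)]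
    exact congrArg y (s.1.symm_apply_apply m)

theorem wreathVN_eq_mPart {P : L2 Z2 →L[ℂ] L2 Z2} {ε : ℤˣ}
    (hP : ∀ x n, evalChar x (copyAt P n) = if x n = ε then 1 else 0) :
    (wreathVN : Set (L2 WreathG →L[ℂ] L2 WreathG)) = mPart P := by
  let := weakStarTopology (L2 WreathG)
  refine (mPart_subset hP).antisymm' fun x hx => ?_
  exact mem_closure_of_tendsto (tendsto_trunc (mem_wreathVN_iff.1 hx).1)
    (Eventually.of_forall fun n => trunc_mem_span hP hx n)

end Truncation

/-! ### Invariance and exoticness -/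

section Exotic

/-- The signs `χ(g)` and `χ(g⁻¹)` picked up by `parityOp` cancel, and `u_v g = g u_{v'}` with `v'`
again in `ℤ₂^∞`. -/
theorem isInvariant_wreathVN : IsInvariant wreathVN := by
  intro g m hm
  obtain ⟨hmG, hv, hp⟩ := mem_wreathVN_iff.1 hm
  have hparity : ∀ g, parityOp * (leftReg WreathG g * m * leftReg WreathG g⁻¹) =
      leftReg WreathG g * m * leftReg WreathG g⁻¹ * parityOp := by
    intro g
    calc parityOp * (leftReg WreathG g * m * leftReg WreathG g⁻¹)
        = (parityOp * leftReg WreathG g) * m * leftReg WreathG g⁻¹ := by simp only [mul_assoc]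
      _ = signCast (parity g) • (leftReg WreathG g * (parityOp * m) * leftReg WreathG g⁻¹) := by
          rw [parityOp_mul_leftReg]
          simp only [smul_mul_assoc, mul_assoc]
      _ = signCast (parity g) • (leftReg WreathG g * m * (parityOp * leftReg WreathG g⁻¹)) := by
          rw [hp]
          simp only [mul_assoc]
      _ = _ := by
          rw [parityOp_mul_leftReg, map_inv, Int.units_inv_eq_self, mul_smul_comm, smul_smul,
            signCast_mul_self, one_smul]
          simp only [mul_assoc]
  rw [star_leftReg]
  refine mem_wreathVN_iff.2
    ⟨mul_mem (mul_mem (leftReg_mem _) hmG) (leftReg_mem _), fun v => ?_, hparity g⟩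
  have hconj : (SemidirectProduct.inl v * g : WreathG) =
      g * SemidirectProduct.inl (permAction g.right⁻¹ v) := by
    ext1
    · simp only [SemidirectProduct.mul_left, SemidirectProduct.left_inl,
        SemidirectProduct.right_inl, map_one, MulAut.one_apply]
      rw [← MulAut.mul_apply, ← map_mul, mul_inv_cancel, map_one, MulAut.one_apply, mul_comm]
    · simp
  have hconj' : (SemidirectProduct.inl (permAction g.right⁻¹ v) * g⁻¹ : WreathG) =
      g⁻¹ * SemidirectProduct.inl v := by
    rw [mul_inv_eq_iff_eq_mul, mul_assoc, hconj, inv_mul_cancel_left]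
  rw [← mul_assoc, ← mul_assoc, ← map_mul, hconj, map_mul, mul_assoc _ _ m, hv, ← mul_assoc,
    mul_assoc _ _ (leftReg WreathG g⁻¹), ← map_mul, hconj', map_mul,
    mul_assoc _ (leftReg WreathG g⁻¹)]

/-- The product of the transposition `(1 2)` and the generator of the `n`-th copy of `ℤ₂`. -/
def twisted (n : ℕ) : WreathG :=
  SemidirectProduct.inr (transposition 1 2) *
    SemidirectProduct.inl (coord n (Multiplicative.ofAdd 1))

theorem permAction_coord (s : SInf) (n : ℕ) (z : Z2) : permAction s (coord n z) = coord (s.1 n) z :=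
  Finsupp.equivMapDomain_single _ _ _

theorem coord_ne {m n : ℕ} (h : m ≠ n) :
    coord m (Multiplicative.ofAdd 1) ≠ coord n (Multiplicative.ofAdd 1) := by
  intro h'
  have := congrArg (pairing (Function.update 1 n (-1))) h'
  rw [pairing_coord, pairing_coord, Function.update_self, Function.update_of_ne h,
    Pi.one_apply, one_uzpow, toAdd_ofAdd, uzpow_one] at this
  exact absurd this (by decide)

theorem twisted_ne : twisted 1 ≠ twisted 2 := fun h =>
  coord_ne (by norm_num) (SemidirectProduct.inl_injective (mul_left_cancel h))

theorem parity_twisted (n : ℕ) : parity (twisted n) = 1 := by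
  rw [twisted, map_mul, parity_inr, parity_inl, sgn_transposition (by norm_num), pairing_coord,
    toAdd_ofAdd, uzpow_one]
  exact Int.units_mul_self (-1)

theorem inl_mul_twisted (v : Z2Inf) (n : ℕ) :
    SemidirectProduct.inl v * twisted n = SemidirectProduct.inr (transposition 1 2) *
      SemidirectProduct.inl
        (permAction (transposition 1 2)⁻¹ v * coord n (Multiplicative.ofAdd 1)) := by
  rw [twisted, ← mul_assoc, inl_mul_inr, mul_assoc, ← map_mul]

theorem twisted_mul_inl (v : Z2Inf) (n : ℕ) :
    twisted n * SemidirectProduct.inl v = SemidirectProduct.inr (transposition 1 2) *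
      SemidirectProduct.inl (coord n (Multiplicative.ofAdd 1) * v) := by
  rw [twisted, mul_assoc, ← map_mul]

theorem inl_coord_mul_twisted_ne :
    SemidirectProduct.inl (coord 1 (Multiplicative.ofAdd 1)) * twisted 1 ≠
      twisted 1 * SemidirectProduct.inl (coord 1 (Multiplicative.ofAdd 1)) := by
  intro h
  rw [inl_mul_twisted, twisted_mul_inl] at h
  have h' := mul_right_cancel (SemidirectProduct.inl_injective (mul_left_cancel h))
  rw [permAction_coord] at h'
  refine coord_ne (m := 2) (n := 1) (by norm_num) ?_
  exact h'

/-- Conjugation by `v` multiplies the vector part by `s⁻¹v · v`, where `s = (12)`. This is trivial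
if `v` agrees at `1` and `2`, and otherwise is the product of the two generators, which exchanges
`twisted 1` and `twisted 2`. -/
theorem inl_mul_twisted_cases (v : Z2Inf) :
    (SemidirectProduct.inl v * twisted 1 = twisted 1 * SemidirectProduct.inl v ∧
      SemidirectProduct.inl v * twisted 2 = twisted 2 * SemidirectProduct.inl v) ∨
    (SemidirectProduct.inl v * twisted 1 = twisted 2 * SemidirectProduct.inl v ∧
      SemidirectProduct.inl v * twisted 2 = twisted 1 * SemidirectProduct.inl v) := by
  simp only [inl_mul_twisted, twisted_mul_inl, mul_right_inj, SemidirectProduct.inl_inj]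
  have hcoord : ∀ k n, (coord k (Multiplicative.ofAdd 1)).toAdd n = if k = n then 1 else 0 :=
    fun k n => Finsupp.single_apply
  have hv : ∀ n, (permAction (transposition 1 2)⁻¹ v).toAdd n =
      v.toAdd (Equiv.swap 1 2 n) := fun n => rfl
  have hext : ∀ k l, (∀ n, v.toAdd (Equiv.swap 1 2 n) + (if k = n then 1 else 0) =
      (if l = n then 1 else 0) + v.toAdd n) → permAction (transposition 1 2)⁻¹ v *
        coord k (Multiplicative.ofAdd 1) = coord l (Multiplicative.ofAdd 1) * v := by
    intro k l h
    refine Multiplicative.toAdd.injective (Finsupp.ext fun n => ?_)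
    rw [toAdd_mul, toAdd_mul, Finsupp.add_apply, Finsupp.add_apply, hcoord, hcoord, hv, h]
  by_cases hc : v.toAdd 1 = v.toAdd 2
  · have hswap : ∀ n, v.toAdd (Equiv.swap 1 2 n) = v.toAdd n := fun n => by
      rw [Equiv.swap_apply_def]
      split_ifs with h1 h2
      · rw [h1, hc]
      · rw [h2, hc]
      · rfl
    exact Or.inl ⟨hext _ _ fun n => by rw [hswap, add_comm],
      hext _ _ fun n => by rw [hswap, add_comm]⟩
  · have hdec : ∀ a b : ZMod 2, a ≠ b → a = 1 + b ∧ b = 1 + a ∧ a + 1 = b ∧ b + 1 = a := by decide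
    obtain ⟨e1, e2, e3, e4⟩ := hdec _ _ hc
    have hcases : ∀ n : ℕ, n = 1 ∨ n = 2 ∨ (n ≠ 1 ∧ n ≠ 2) := fun n => by omega
    refine Or.inr ⟨hext _ _ fun n => ?_, hext _ _ fun n => ?_⟩ <;>
      obtain rfl | rfl | ⟨h1, h2⟩ := hcases n
    · rw [Equiv.swap_apply_left, if_pos rfl, if_neg (by norm_num), e4, zero_add]
    · rw [Equiv.swap_apply_right, if_neg (by norm_num), if_pos rfl, add_zero, e1]
    · rw [Equiv.swap_apply_of_ne_of_ne h1 h2, if_neg h1.symm, if_neg h2.symm, add_comm]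
    · rw [Equiv.swap_apply_left, if_neg (by norm_num), if_pos rfl, add_zero, e2]
    · rw [Equiv.swap_apply_right, if_pos rfl, if_neg (by norm_num), e3, zero_add]
    · rw [Equiv.swap_apply_of_ne_of_ne h1 h2, if_neg h1.symm, if_neg h2.symm, add_comm]

theorem twisted_add_mem :
    leftReg WreathG (twisted 1) + leftReg WreathG (twisted 2) ∈ wreathVN := by
  refine mem_wreathVN_iff.2 ⟨add_mem (leftReg_mem _) (leftReg_mem _), fun v => ?_, ?_⟩
  · simp only [mul_add, add_mul, ← map_mul]
    rcases inl_mul_twisted_cases v with ⟨h1, h2⟩ | ⟨h1, h2⟩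
    · rw [h1, h2]
    · rw [h1, h2, add_comm]
  · rw [mul_add, parityOp_mul_leftReg, parityOp_mul_leftReg, parity_twisted, parity_twisted,
      map_one, one_smul, one_smul, add_mul]

/-- If the algebra were `L(N)`, the support of `twisted 1 + twisted 2` would lie in `N`. Then
`twisted 1` alone would belong to the algebra, but it does not commute with the generator of the
first coordinate. -/
theorem isExotic_wreathVN : IsExotic wreathVN := by
  intro N _ hN
  have h1 : twisted 1 ∈ N := by
    by_contra hc
    have h := fourierCoeff_eq_zero_of_mem_subgroupVN (hN ▸ twisted_add_mem) hc
    have h' : fourierCoeff (leftReg WreathG (twisted 1)) (twisted 1) +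
      fourierCoeff (leftReg WreathG (twisted 2)) (twisted 1) = 0 := h
    rw [fourierCoeff_leftReg_self, fourierCoeff_leftReg_ne twisted_ne, add_zero] at h'
    exact one_ne_zero h'
  have h2 : leftReg WreathG (twisted 1) ∈ wreathVN := hN ▸ leftReg_mem_subgroupVN h1
  have h3 := (mem_wreathVN_iff.1 h2).2.1 (coord 1 (Multiplicative.ofAdd 1))
  rw [← map_mul, ← map_mul] at h3
  exact inl_coord_mul_twisted_ne (leftReg_injective h3)

end Exotic

/-! ### The conditional expectation -/

section Expectation

/-- The unitaries `u_v` and `u_v · parityOp`. -/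
def averagingOp (i : Z2Inf × Bool) : L2 WreathG →L[ℂ] L2 WreathG :=
  leftReg WreathG (SemidirectProduct.inl i.1) * bif i.2 then parityOp else 1

/-- The finite sets of unitaries over which we average. -/
def averagingSet (n : ℕ) : Finset (Z2Inf × Bool) :=
  (finite_vecLevel n).toFinset ×ˢ Finset.univ

theorem averagingSet_nonempty (n : ℕ) : (averagingSet n).Nonempty :=
  ⟨(1, true), by simp [averagingSet, one_mem]⟩

theorem averagingOp_mem_unitary (i : Z2Inf × Bool) :
    averagingOp i ∈ unitary (L2 WreathG →L[ℂ] L2 WreathG) := by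
  refine mul_mem (leftReg_mem_unitary _) ?_
  cases i.2
  · exact one_mem _
  · exact parityOp_mem_unitary

theorem averagingOp_conj (i : Z2Inf × Bool) (x : L2 WreathG →L[ℂ] L2 WreathG) :
    averagingOp i * x * star (averagingOp i) = leftReg WreathG (SemidirectProduct.inl i.1) *
      (bif i.2 then parityOp * x * star parityOp else x) *
        star (leftReg WreathG (SemidirectProduct.inl i.1)) := by
  rw [averagingOp, star_mul]
  cases i.2 <;> simp [mul_assoc]

theorem averagingOp_conj_mem (i : Z2Inf × Bool) (x : L2 WreathG →L[ℂ] L2 WreathG)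
    (hx : x ∈ groupVN WreathG) :
    averagingOp i * x * star (averagingOp i) ∈ groupVN WreathG := by
  rw [averagingOp_conj]
  refine mul_mem (mul_mem (leftReg_mem _) ?_) (star_mem (leftReg_mem _))
  cases i.2
  · exact hx
  · exact parityOp_conj_mem hx

theorem trace_averagingOp_conj (i : Z2Inf × Bool) (x : L2 WreathG →L[ℂ] L2 WreathG)
    (hx : x ∈ groupVN WreathG) :
    trace (averagingOp i * x * star (averagingOp i)) = trace x := by
  rw [averagingOp_conj]
  cases i.2
  · exact trace_leftReg_conj hx _
  · exact (trace_leftReg_conj (parityOp_conj_mem hx) _).trans (trace_parityOp_conj x)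

/-- The operators form a group only up to signs; the signs disappear under conjugation, so the
averages are averages over finite groups of automorphisms. -/
theorem averagingOp_mul (i j : Z2Inf × Bool) : ∃ u : ℤˣ, averagingOp i * averagingOp j =
    signCast u • averagingOp (i.1 * j.1, xor i.2 j.2) := by
  obtain ⟨v, b⟩ := i
  obtain ⟨w, b'⟩ := j
  cases b
  · exact ⟨1, by simp [averagingOp, mul_assoc]⟩
  · refine ⟨parity (SemidirectProduct.inl w), ?_⟩
    have h : averagingOp (v, true) * averagingOp (w, b') =
        leftReg WreathG (SemidirectProduct.inl v) *
          (parityOp * leftReg WreathG (SemidirectProduct.inl w)) *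
            bif b' then parityOp else 1 := by
      simp [averagingOp, mul_assoc]
    rw [h, parityOp_mul_leftReg]
    cases b' <;> simp [averagingOp, mul_assoc, parityOp_mul_self]

theorem averagingOp_mul_conj (i j : Z2Inf × Bool) (x : L2 WreathG →L[ℂ] L2 WreathG) :
    averagingOp i * (averagingOp j * x * star (averagingOp j)) * star (averagingOp i) =
      averagingOp (i.1 * j.1, xor i.2 j.2) * x * star (averagingOp (i.1 * j.1, xor i.2 j.2)) := by
  obtain ⟨u, hu⟩ := averagingOp_mul i j
  have h : averagingOp i * (averagingOp j * x * star (averagingOp j)) * star (averagingOp i) =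
      averagingOp i * averagingOp j * x * star (averagingOp i * averagingOp j) := by
    rw [star_mul]
    simp only [mul_assoc]
  rw [h, hu, star_smul, smul_mul_assoc, smul_mul_assoc, mul_smul_comm, smul_smul,
    ← starRingEnd_apply, star_signCast, signCast_mul_self, one_smul]

theorem sum_averagingSet_shift {A : Type*} [AddCommMonoid A] {v : Z2Inf} {n : ℕ}
    (hv : v ∈ vecLevel n) (b : Bool) (f : Z2Inf × Bool → A) :
    ∑ j ∈ averagingSet n, f (v * j.1, xor b j.2) = ∑ j ∈ averagingSet n, f j := by
  have hmem : ∀ j : Z2Inf × Bool, j ∈ averagingSet n ↔ j.1 ∈ vecLevel n := fun j => by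
    simp only [averagingSet, Finset.mem_product, Finset.mem_univ, and_true,
      Set.Finite.mem_toFinset, SetLike.mem_coe]
  refine Finset.sum_nbij' (fun j => (v * j.1, xor b j.2)) (fun j => (v⁻¹ * j.1, xor b j.2))
    (fun j hj => (hmem _).2 (mul_mem hv ((hmem j).1 hj)))
    (fun j hj => (hmem _).2 (mul_mem (inv_mem hv) ((hmem j).1 hj)))
    (fun j _ => ?_) (fun j _ => ?_) fun j _ => rfl
  · simp
  · simp

theorem averagingOp_conj_avgConj_of_mem {i : Z2Inf × Bool} {n : ℕ} (hn : i.1 ∈ vecLevel n)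
    (x : L2 WreathG →L[ℂ] L2 WreathG) :
    averagingOp i * avgConj averagingOp (averagingSet n) x * star (averagingOp i) =
      avgConj averagingOp (averagingSet n) x := by
  rw [avgConj_apply, mul_smul_comm, smul_mul_assoc, Finset.mul_sum, Finset.sum_mul,
    Finset.sum_congr rfl fun j _ => averagingOp_mul_conj i j x]
  exact congrArg _ (sum_averagingSet_shift hn i.2
    fun j => averagingOp j * x * star (averagingOp j))

theorem averagingOp_conj_avgConj (i : Z2Inf × Bool) (x : L2 WreathG →L[ℂ] L2 WreathG) :
    ∀ᶠ n in atTop, averagingOp i * avgConj averagingOp (averagingSet n) x * star (averagingOp i) =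
      avgConj averagingOp (averagingSet n) x :=
  (eventually_mem_vecLevel i.1).mono fun _ hn => averagingOp_conj_avgConj_of_mem hn x

theorem mem_wreathVN_iff_averagingOp (x : L2 WreathG →L[ℂ] L2 WreathG) :
    x ∈ wreathVN ↔ x ∈ groupVN WreathG ∧ ∀ i, averagingOp i * x = x * averagingOp i := by
  rw [mem_wreathVN_iff]
  refine and_congr_right fun _ => ⟨?_, fun h => ⟨fun v => ?_, ?_⟩⟩
  · rintro ⟨hv, hp⟩ ⟨v, b⟩
    cases b
    · simpa [averagingOp] using hv v
    · simp only [averagingOp, cond_true]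
      rw [mul_assoc, hp, ← mul_assoc, hv, mul_assoc]
  · simpa [averagingOp] using h (v, false)
  · simpa [averagingOp] using h (1, true)

/-- For each `v` the terms with and without `parityOp` are opposite, because a transposition has
sign `-1`. -/
theorem avgConj_transposition (n : ℕ) : avgConj averagingOp (averagingSet n)
    (leftReg WreathG (SemidirectProduct.inr (transposition 1 2))) = 0 := by
  rw [avgConj_apply, averagingSet, Finset.sum_product]
  refine (congrArg _ (Finset.sum_eq_zero fun v _ => ?_)).trans (smul_zero _)
  rw [Fintype.sum_bool, averagingOp_conj, averagingOp_conj]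
  simp only [cond_true, cond_false]
  rw [parityOp_conj_leftReg, parity_inr, sgn_transposition (by norm_num), signCast_neg, map_one]
  simp

end Expectation

end WreathVN

end

open WreathVN in
theorem mainTheorem7 (P₁ : L2 Z2 →L[ℂ] L2 Z2) (hL : P₁ ∈ groupVN Z2)
    (hP : IsStarProjection P₁) (h0 : P₁ ≠ 0) (h1 : P₁ ≠ 1) :
    ∃ M : VonNeumannAlgebra (L2 WreathG),
      (M : Set (L2 WreathG →L[ℂ] L2 WreathG)) = mPart P₁ ∧
      IsInvariant M ∧
      IsExotic M ∧
      ∃ hM : M ≤ groupVN WreathG,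
      ∃ E : (groupVN WreathG).toStarSubalgebra →ₗ[ℂ] M.toStarSubalgebra,
        IsTraceCondExp hM E ∧
        (∀ E' : (groupVN WreathG).toStarSubalgebra →ₗ[ℂ] M.toStarSubalgebra,
          IsTraceCondExp hM E' → E' = E) ∧
        E ⟨leftReg WreathG (SemidirectProduct.inr (transposition 1 2)), leftReg_mem _⟩ = 0 := by
  obtain ⟨ε, hc1, hc2⟩ := exists_sign_of_projection hL hP h0 h1
  obtain ⟨hM, E, hE, hzero⟩ := exists_isTraceCondExp averagingOp_mem_unitary averagingOp_conj_mem
    trace_averagingOp_conj mem_wreathVN_iff_averagingOp averagingSet_nonempty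
    averagingOp_conj_avgConj
  exact ⟨wreathVN, wreathVN_eq_mPart (evalChar_copyAt hc1 hc2), isInvariant_wreathVN,
    isExotic_wreathVN, hM, E, hE, fun E' hE' => hE.unique hE', hzero _ avgConj_transposition⟩
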